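/- Let $M$ be a connected smooth manifold of dimension $m\ge 1$ with a smooth pseudo-Riemannian (in particular, possibly Riemannian) metric $g$ of any signature, and let $H(x,p)=\tfrac12 g^{ij}(x)p_ip_j$ be the corresponding Hamiltonian on $T^*M$, where $\{\cdot,\cdot\}$ is the canonical Poisson bracket. Let $L$ be any smooth function on $T^*M$ that is linear in momenta (a cofactor), and let $d\ge 0$. Denote by $\mathcal K^L_{m,d}(g)$ the linear space of $L$-relative Killing $d$-tensors, i.e. of the smooth functions $K(x,p)=K^{i_1\dots i_d}(x)p_{i_1}\cdots p_{i_d}$ on $T^*M$, homogeneous polynomial of degree $d$ in momenta, such that $\{H,K\}=L\cdot K$. Then $\mathcal K^L_{m,d}(g)$ is finite-dimensional and $$\dim\mathcal K^L_{m,d}(g)\le\Lambda_{m,d}:=\frac{(m+d-1)!\,(m+d)!}{(m-1)!\,m!\,d!\,(d+1)!}.$$ -/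

import Mathlib

open scoped Manifold ContDiff Nat

noncomputable section

namespace RelativeKilling

variable {m : ℕ} {M : Type*} [TopologicalSpace M] [ChartedSpace (EuclideanSpace ℝ (Fin m)) M]

/-- The cotangent space `T*_x M` of an `m`-dimensional manifold. -/
abbrev Cotangent (m : ℕ) {M : Type*} [TopologicalSpace M]
    [ChartedSpace (EuclideanSpace ℝ (Fin m)) M] (x : M) : Type :=
  TangentSpace (𝓡 m) x →L[ℝ] ℝ

/-- Real-valued functions `F(x, p)` on the cotangent bundle `T*M`. -/
abbrev CotangentFun (m : ℕ) (M : Type*) [TopologicalSpace M]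
    [ChartedSpace (EuclideanSpace ℝ (Fin m)) M] : Type _ :=
  ∀ x : M, Cotangent m x → ℝ

/-- The `i`-th standard basis vector of the coordinate space. -/
abbrev stdVec (i : Fin m) : EuclideanSpace ℝ (Fin m) := EuclideanSpace.single i 1

/-- The coordinate vector `∂/∂qⁱ` of the chart `e`, at the point with coordinates `q`. -/
def coordVec (e : OpenPartialHomeomorph M (EuclideanSpace ℝ (Fin m)))
    (q : EuclideanSpace ℝ (Fin m)) (i : Fin m) : TangentSpace (𝓡 m) (e.symm q) :=
  mfderiv (𝓡 m) (𝓡 m) e.symm q (stdVec i)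

/-- The coordinate covector `dqⁱ` of the chart `e`, at the point with coordinates `q`. -/
def coordCovec (e : OpenPartialHomeomorph M (EuclideanSpace ℝ (Fin m)))
    (q : EuclideanSpace ℝ (Fin m)) (i : Fin m) : Cotangent m (e.symm q) :=
  (EuclideanSpace.proj i : EuclideanSpace ℝ (Fin m) →L[ℝ] ℝ).comp
    (mfderiv (𝓡 m) (𝓡 m) e (e.symm q))

/-- The expression `F(q, p)` of a function on `T*M` in the canonical coordinates `(qⁱ, pᵢ)` that
the chart `e` induces on `T*M`: the covector with momenta `pᵢ` is `∑ pᵢ dqⁱ`. -/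
def inCoords (e : OpenPartialHomeomorph M (EuclideanSpace ℝ (Fin m))) (F : CotangentFun m M)
    (q p : EuclideanSpace ℝ (Fin m)) : ℝ :=
  F (e.symm q) (∑ i, p i • coordCovec e q i)

/-- The canonical Poisson bracket
`{F, G} = X_F(G) = ∑ᵢ (∂F/∂pᵢ ∂G/∂qⁱ - ∂F/∂qⁱ ∂G/∂pᵢ)` of functions on `T*M`, in the
canonical coordinates induced by the chart `e`. -/
def poissonBracket (e : OpenPartialHomeomorph M (EuclideanSpace ℝ (Fin m)))
    (F G : CotangentFun m M) (q p : EuclideanSpace ℝ (Fin m)) : ℝ :=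
  ∑ i, (fderiv ℝ (fun p' => inCoords e F q p') p (stdVec i)
          * fderiv ℝ (fun q' => inCoords e G q' p) q (stdVec i)
        - fderiv ℝ (fun q' => inCoords e F q' p) q (stdVec i)
          * fderiv ℝ (fun p' => inCoords e G q p') p (stdVec i))

/-- A smooth pseudo-Riemannian metric, of any signature: a symmetric nondegenerate bilinear form
on each tangent space, whose components `g_ij` are smooth in all charts. -/
structure PseudoRiemannianMetric (m : ℕ) (M : Type*) [TopologicalSpace M]
    [ChartedSpace (EuclideanSpace ℝ (Fin m)) M] where
  /-- the bilinear form at each point -/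
  val : ∀ x : M, TangentSpace (𝓡 m) x →L[ℝ] TangentSpace (𝓡 m) x →L[ℝ] ℝ
  symm : ∀ (x : M) (v w : TangentSpace (𝓡 m) x), val x v w = val x w v
  nondegenerate : ∀ (x : M) (v : TangentSpace (𝓡 m) x), (∀ w, val x v w = 0) → v = 0
  smooth : ∀ e ∈ atlas (EuclideanSpace ℝ (Fin m)) M, ∀ i j : Fin m,
    ContDiffOn ℝ ∞ (fun q => val (e.symm q) (coordVec e q i) (coordVec e q j)) e.target

instance (x : M) : FiniteDimensional ℝ (TangentSpace (𝓡 m) x) :=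
  inferInstanceAs (FiniteDimensional ℝ (EuclideanSpace ℝ (Fin m)))

theorem PseudoRiemannianMetric.bijective (g : PseudoRiemannianMetric m M) (x : M) :
    Function.Bijective (g.val x : TangentSpace (𝓡 m) x →ₗ[ℝ] Cotangent m x) := by
  have hinj : Function.Injective (g.val x : TangentSpace (𝓡 m) x →ₗ[ℝ] Cotangent m x) := by
    rw [injective_iff_map_eq_zero]
    intro v hv
    refine g.nondegenerate x v fun w => ?_
    have h : g.val x v = 0 := hv
    rw [h]; rfl
  have hfin : Module.finrank ℝ (TangentSpace (𝓡 m) x) = Module.finrank ℝ (Cotangent m x) := by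
    have : T2Space (TangentSpace (𝓡 m) x) :=
      inferInstanceAs (T2Space (EuclideanSpace ℝ (Fin m)))
    rw [← (LinearMap.toContinuousLinearMap (𝕜 := ℝ) (E := TangentSpace (𝓡 m) x)
      (F' := ℝ)).finrank_eq]
    exact (Subspace.dual_finrank_eq (K := ℝ) (V := TangentSpace (𝓡 m) x)).symm
  exact ⟨hinj, (LinearMap.injective_iff_surjective_of_finrank_eq_finrank hfin).1 hinj⟩

/-- Raising the index of a covector: `g(p♯, w) = p(w)` for all `w`. -/
def PseudoRiemannianMetric.sharp (g : PseudoRiemannianMetric m M) (x : M) (p : Cotangent m x) :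
    TangentSpace (𝓡 m) x :=
  (LinearEquiv.ofBijective _ (g.bijective x)).symm p

/-- The Hamiltonian `H(x, p) = ½ gⁱʲ(x) pᵢ pⱼ = ½ p(p♯)` of the geodesic flow. -/
def PseudoRiemannianMetric.hamiltonian (g : PseudoRiemannianMetric m M) : CotangentFun m M :=
  fun x p => (1 / 2 : ℝ) * p (g.sharp x p)

/-- `K(x, p) = K^{i₁…i_d}(x) p_{i₁} ⋯ p_{i_d}` is a smooth symmetric contravariant `d`-tensor,
seen as a function on `T*M`: on each cotangent space it is a homogeneous polynomial of degree `d`,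
and it is smooth in canonical coordinates. -/
structure IsSymTensor (d : ℕ) (K : CotangentFun m M) : Prop where
  homogeneous : ∀ x : M, ∃ A : MultilinearMap ℝ (fun _ : Fin d => Cotangent m x) ℝ,
    ∀ p, K x p = A (fun _ => p)
  smooth : ∀ e ∈ atlas (EuclideanSpace ℝ (Fin m)) M,
    ContDiffOn ℝ ∞ (fun z : EuclideanSpace ℝ (Fin m) × EuclideanSpace ℝ (Fin m) =>
      inCoords e K z.1 z.2) (e.target ×ˢ Set.univ)

/-- `{H, K} = L · K` on the cotangent bundle. The bracket does not depend on the chart; the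
equation is written in the canonical coordinates of each chart. -/
def IsRelativeKilling (g : PseudoRiemannianMetric m M) (L K : CotangentFun m M) : Prop :=
  ∀ e ∈ atlas (EuclideanSpace ℝ (Fin m)) M, ∀ q ∈ e.target, ∀ p : EuclideanSpace ℝ (Fin m),
    poissonBracket e g.hamiltonian K q p = inCoords e L q p * inCoords e K q p

theorem IsSymTensor.differentiableAt_fst {d : ℕ} {K : CotangentFun m M} (hK : IsSymTensor d K)
    {e : OpenPartialHomeomorph M (EuclideanSpace ℝ (Fin m))}
    (he : e ∈ atlas (EuclideanSpace ℝ (Fin m)) M) {q : EuclideanSpace ℝ (Fin m)}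
    (hq : q ∈ e.target) (p : EuclideanSpace ℝ (Fin m)) :
    DifferentiableAt ℝ (fun q' => inCoords e K q' p) q := by
  have h := ((hK.smooth e he).contDiffAt (x := (q, p))
    ((e.open_target.prod isOpen_univ).mem_nhds ⟨hq, trivial⟩)).differentiableAt (by simp)
  exact h.comp (f := fun q' : EuclideanSpace ℝ (Fin m) => (q', p)) q (by fun_prop)

theorem IsSymTensor.differentiableAt_snd {d : ℕ} {K : CotangentFun m M} (hK : IsSymTensor d K)
    {e : OpenPartialHomeomorph M (EuclideanSpace ℝ (Fin m))}
    (he : e ∈ atlas (EuclideanSpace ℝ (Fin m)) M) {q : EuclideanSpace ℝ (Fin m)}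
    (hq : q ∈ e.target) (p : EuclideanSpace ℝ (Fin m)) :
    DifferentiableAt ℝ (fun p' => inCoords e K q p') p := by
  have h := ((hK.smooth e he).contDiffAt (x := (q, p))
    ((e.open_target.prod isOpen_univ).mem_nhds ⟨hq, trivial⟩)).differentiableAt (by simp)
  exact h.comp (f := fun p' : EuclideanSpace ℝ (Fin m) => (q, p')) p (by fun_prop)

/-- The linear space of `L`-relative Killing `d`-tensors of `g`. -/
def relativeKillingTensors (g : PseudoRiemannianMetric m M) (L : CotangentFun m M) (d : ℕ) :
    Submodule ℝ (CotangentFun m M) where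
  carrier := {K | IsSymTensor d K ∧ IsRelativeKilling g L K}
  zero_mem' := by
    refine ⟨⟨fun x => ⟨0, fun p => rfl⟩, fun e he => ?_⟩, fun e he q hq p => ?_⟩
    · exact contDiffOn_const (c := (0 : ℝ))
    · simp [poissonBracket, inCoords]
  add_mem' := by
    rintro K₁ K₂ ⟨h₁, k₁⟩ ⟨h₂, k₂⟩
    refine ⟨⟨fun x => ?_, fun e he => (h₁.smooth e he).add (h₂.smooth e he)⟩,
      fun e he q hq p => ?_⟩
    · obtain ⟨A₁, hA₁⟩ := h₁.homogeneous x
      obtain ⟨A₂, hA₂⟩ := h₂.homogeneous x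
      exact ⟨A₁ + A₂, fun p => by simp [hA₁, hA₂]⟩
    · have e₁ := k₁ e he q hq p
      have e₂ := k₂ e he q hq p
      have hq' : fderiv ℝ (fun q' => inCoords e (K₁ + K₂) q' p) q
          = fderiv ℝ (fun q' => inCoords e K₁ q' p) q
            + fderiv ℝ (fun q' => inCoords e K₂ q' p) q :=
        fderiv_add (h₁.differentiableAt_fst he hq p) (h₂.differentiableAt_fst he hq p)
      have hp' : fderiv ℝ (fun p' => inCoords e (K₁ + K₂) q p') p
          = fderiv ℝ (fun p' => inCoords e K₁ q p') p
            + fderiv ℝ (fun p' => inCoords e K₂ q p') p :=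
        fderiv_add (h₁.differentiableAt_snd he hq p) (h₂.differentiableAt_snd he hq p)
      have hs : inCoords e (K₁ + K₂) q p = inCoords e K₁ q p + inCoords e K₂ q p := rfl
      rw [hs, mul_add, ← e₁, ← e₂]
      simp only [poissonBracket, hq', hp', ← Finset.sum_add_distrib, add_apply]
      refine Finset.sum_congr rfl fun i _ => ?_
      ring
  smul_mem' := by
    rintro c K ⟨h, k⟩
    refine ⟨⟨fun x => ?_, fun e he => (h.smooth e he).const_smul c⟩, fun e he q hq p => ?_⟩
    · obtain ⟨A, hA⟩ := h.homogeneous x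
      exact ⟨c • A, fun p => by simp [hA]⟩
    · have e₁ := k e he q hq p
      have hq' : fderiv ℝ (fun q' => inCoords e (c • K) q' p) q
          = c • fderiv ℝ (fun q' => inCoords e K q' p) q :=
        fderiv_const_smul (h.differentiableAt_fst he hq p) c
      have hp' : fderiv ℝ (fun p' => inCoords e (c • K) q p') p
          = c • fderiv ℝ (fun p' => inCoords e K q p') p :=
        fderiv_const_smul (h.differentiableAt_snd he hq p) c
      have hs : inCoords e (c • K) q p = c * inCoords e K q p := rfl
      rw [hs, mul_left_comm, ← e₁]
      simp only [poissonBracket, hq', hp', Finset.mul_sum, smul_apply,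
        smul_eq_mul]
      refine Finset.sum_congr rfl fun i _ => ?_
      ring

/-- The number `Λ_{m,d} = (m+d-1)! (m+d)! / ((m-1)! m! d! (d+1)!)`, for `m ≥ 1`. -/
def killingBound (m d : ℕ) : ℚ :=
  ((m + d - 1)! * (m + d)! : ℚ) / ((m - 1)! * m ! * d ! * (d + 1)!)

end RelativeKilling

end

/-! Fix a point x and filter the space of relative Killing tensors by order of vanishing at x. The
bound is the sum of the dimensions that the successive quotients can have.

Graded pieces. Let K vanish to order n at x, and write its n-th order leading part in the
displacement h and the velocity v, where p = g(x)v. It is a polynomial Q(h, v) of bidegree (n, d).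
In {H, K} = L K only the term gⁱʲ pᵢ ∂ⱼK differentiates K in position; the terms from ∂H/∂q and from
L still vanish to order n. At order n - 1 there remains ∑ vⱼ ∂Q/∂hⱼ = 0, so Q lies in `raiseKer m n
d`: neither L nor the curvature enters, and Q is a leading part allowed for flat space
(`leadingPart_mem_raiseKer`).

Dimension count. `raise` and `lower` generate an sl₂ action, which makes `raise` surjective from
bidegree (a + 1, b) to (a, b + 1) for a ≤ b (`raiseMap_surjective`). The kernels then have known
dimensions, whose sum over n = 0, ..., d telescopes to Λ (`sum_finrank_raiseKer`).

The filtration stops at n = d + 1. Suppose K vanishes to order d + 1 at x₀ and let q be close to x₀.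
Some momentum p₀ at q shoots a solution of the geodesic flow that lies over x₀ at time τ. Along the
flow K solves a linear scalar equation, so K(q, p) is bounded by a constant times its value at the
endpoint, and this is O(‖p - p₀‖^(d+1)) because the endpoint depends on p in a Lipschitz way. A
polynomial of degree d in p with this property is zero. So K vanishes near x₀
(`exists_ball_forall_eq_zero`), and by connectedness everywhere (`eq_zero_of_vanishesToOrder`). -/

/-! ### The sl₂ action on bihomogeneous polynomials and the dimension count -/

noncomputable section

namespace RelativeKilling

open MvPolynomial

/-- Polynomials in positions `X (inl i)` and momenta `X (inr i)`. -/
abbrev PhasePoly (m : ℕ) : Type := MvPolynomial (Fin m ⊕ Fin m) ℝ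

/-- The bigrading by degree in positions and degree in momenta. -/
def bidegree (m : ℕ) : Fin m ⊕ Fin m → ℕ × ℕ := Sum.elim (fun _ => (1, 0)) (fun _ => (0, 1))

/-- Polynomials of degree `a` in the positions and `b` in the momenta. -/
abbrev bihomogeneous (m a b : ℕ) : Submodule ℝ (PhasePoly m) :=
  weightedHomogeneousSubmodule ℝ (bidegree m) (a, b)

/-- The derivation `∑ pⱼ ∂/∂qⱼ`. -/
def raise (m : ℕ) : Derivation ℝ (PhasePoly m) (PhasePoly m) :=
  ∑ j : Fin m, (X (.inr j) : PhasePoly m) • pderiv (.inl j)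

/-- The derivation `∑ qⱼ ∂/∂pⱼ`. -/
def lower (m : ℕ) : Derivation ℝ (PhasePoly m) (PhasePoly m) :=
  ∑ j : Fin m, (X (.inl j) : PhasePoly m) • pderiv (.inr j)

variable {m a b : ℕ}

theorem derivation_sum_apply {i R A : Type*} [CommSemiring R] [CommSemiring A] [Algebra R A]
    (s : Finset i) (D : i → Derivation R A A) (x : A) : (∑ j ∈ s, D j) x = ∑ j ∈ s, D j x := by
  exact (congrFun (map_sum (Derivation.coeFnAddMonoidHom (R := R) (A := A) (M := A)) D s) x).trans
    (Finset.sum_apply _ _ _)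

theorem raise_apply (f : PhasePoly m) :
    raise m f = ∑ j : Fin m, X (.inr j) * pderiv (.inl j) f := by
  simp [raise, derivation_sum_apply]

theorem lower_apply (f : PhasePoly m) :
    lower m f = ∑ j : Fin m, X (.inl j) * pderiv (.inr j) f := by
  simp [lower, derivation_sum_apply]

theorem raise_mem {f : PhasePoly m} (h : f ∈ bihomogeneous m (a + 1) b) :
    raise m f ∈ bihomogeneous m a (b + 1) := by
  rw [raise_apply]
  refine Submodule.sum_mem _ fun j _ => ?_
  have h1 : (pderiv (.inl j) f).IsWeightedHomogeneous (bidegree m) (a, b) :=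
    IsWeightedHomogeneous.pderiv ((mem_weightedHomogeneousSubmodule _ _ _ _).1 h) (by simp [bidegree])
  have h2 := (isWeightedHomogeneous_X ℝ (bidegree m) (.inr j)).mul h1
  rw [mem_weightedHomogeneousSubmodule]
  convert! h2 using 1
  simp [bidegree, add_comm]

theorem lower_mem {f : PhasePoly m} (h : f ∈ bihomogeneous m a (b + 1)) :
    lower m f ∈ bihomogeneous m (a + 1) b := by
  rw [lower_apply]
  refine Submodule.sum_mem _ fun j _ => ?_
  have h1 : (pderiv (.inr j) f).IsWeightedHomogeneous (bidegree m) (a, b) :=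
    IsWeightedHomogeneous.pderiv ((mem_weightedHomogeneousSubmodule _ _ _ _).1 h) (by simp [bidegree])
  have h2 := (isWeightedHomogeneous_X ℝ (bidegree m) (.inl j)).mul h1
  rw [mem_weightedHomogeneousSubmodule]
  convert! h2 using 1
  simp [bidegree, add_comm]

theorem isWeightedHomogeneous_fst {f : PhasePoly m} (h : f ∈ bihomogeneous m a b) :
    f.IsWeightedHomogeneous (fun i => (bidegree m i).1) a := by
  intro c hc
  have := congrArg Prod.fst ((mem_weightedHomogeneousSubmodule _ _ _ _).1 h hc)
  rw [Finsupp.weight_apply, Finsupp.sum, Prod.fst_sum] at this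
  simpa [Finsupp.weight_apply, Finsupp.sum] using this

theorem isWeightedHomogeneous_snd {f : PhasePoly m} (h : f ∈ bihomogeneous m a b) :
    f.IsWeightedHomogeneous (fun i => (bidegree m i).2) b := by
  intro c hc
  have := congrArg Prod.snd ((mem_weightedHomogeneousSubmodule _ _ _ _).1 h hc)
  rw [Finsupp.weight_apply, Finsupp.sum, Prod.snd_sum] at this
  simpa [Finsupp.weight_apply, Finsupp.sum] using this

theorem euler_fst {f : PhasePoly m} (h : f ∈ bihomogeneous m a b) :
    ∑ j : Fin m, X (.inl j) * pderiv (.inl j) f = (a : ℝ) • f := by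
  have := (isWeightedHomogeneous_fst h).sum_weight_X_mul_pderiv
  simpa [bidegree, Nat.cast_smul_eq_nsmul] using this

theorem euler_snd {f : PhasePoly m} (h : f ∈ bihomogeneous m a b) :
    ∑ j : Fin m, X (.inr j) * pderiv (.inr j) f = (b : ℝ) • f := by
  have := (isWeightedHomogeneous_snd h).sum_weight_X_mul_pderiv
  simpa [bidegree, Nat.cast_smul_eq_nsmul] using this

/-- The sl₂ relation: the right side, the momentum Euler field minus the position Euler field, acts
on bidegree (a, b) as b - a. Derivations need only be compared on the generators. -/
theorem commutator_raise_lower :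
    ⁅raise m, lower m⁆ = ∑ j : Fin m, (X (.inr j) : PhasePoly m) • pderiv (.inr j)
      - ∑ j : Fin m, (X (.inl j) : PhasePoly m) • pderiv (.inl j) := by
  classical
  refine derivation_ext fun i => ?_
  rcases i with i | i <;>
  simp [Derivation.commutator_apply, raise_apply, lower_apply, derivation_sum_apply, pderiv_X,
    Pi.single_apply, -Finset.sum_neg_distrib]

theorem raise_lower_sub {f : PhasePoly m} (h : f ∈ bihomogeneous m a b) :
    raise m (lower m f) - lower m (raise m f) = ((b : ℝ) - a) • f := by
  have := congrArg (fun D => D f) (commutator_raise_lower (m := m))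
  simp only [Derivation.commutator_apply, Derivation.sub_apply] at this
  rw [this, sub_smul, ← euler_fst h, ← euler_snd h]
  simp [derivation_sum_apply]

theorem raise_eq_zero {f : PhasePoly m} (h : f ∈ bihomogeneous m 0 b) : raise m f = 0 := by
  rw [raise_apply]
  refine Finset.sum_eq_zero fun j _ => ?_
  rw [pderiv_eq_zero_of_notMem_vars, mul_zero]
  intro hj
  obtain ⟨c, hc, hjc⟩ := (mem_vars_iff_mem_support _).1 hj
  have := isWeightedHomogeneous_fst h (mem_support_iff.1 hc)
  rw [Finsupp.weight_apply, Finsupp.sum, Finset.sum_eq_zero_iff] at this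
  have := this _ hjc
  simp [bidegree] at this
  simp [this] at hjc

/-- For a < b, `raise ∘ lower` has no eigenvalue -c ≤ 0. By the commutator, `raise f` is again an
eigenvector, in bidegree (a - 1, b + 1), with the still smaller eigenvalue -(c + b - a). Induction
on a gives `raise f = 0`, and then the commutator reads -c f = (b - a) f. -/
theorem eq_zero_of_raise_lower_eq (a : ℕ) : ∀ {b : ℕ} {f : PhasePoly m} {c : ℝ},
    f ∈ bihomogeneous m a b → a < b → 0 ≤ c → raise m (lower m f) = -c • f → f = 0 := by
  induction a with
  | zero =>
    intro b f c h hab hc he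
    have := raise_lower_sub h
    rw [he, raise_eq_zero h, map_zero, sub_zero, ← sub_eq_zero, ← sub_smul] at this
    have hb : (0 : ℝ) < b := by exact_mod_cast hab
    rcases smul_eq_zero.1 this with h0 | h0
    · push_cast at h0; linarith
    · exact h0
  | succ a ih =>
    intro b f c h hab hc he
    have hb : ((a + 1 : ℕ) : ℝ) < b := by exact_mod_cast hab
    have hcomm := raise_lower_sub h
    have hr : raise m f = 0 := by
      refine ih (raise_mem h) (by omega) (c := c + (b - (a + 1 : ℕ))) (by linarith) ?_
      have h1 : lower m (raise m f) = (-c - (b - (a + 1 : ℕ))) • f := by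
        rw [sub_smul, ← hcomm, he]; abel
      rw [h1, Derivation.map_smul]; congr 1; ring
    rw [he, hr, map_zero, sub_zero, ← sub_eq_zero, ← sub_smul] at hcomm
    rcases smul_eq_zero.1 hcomm with h0 | h0
    · linarith
    · exact h0

/-- The exponents of bidegree `(a, b)` are pairs of multisets. -/
def bidegreeEquiv (m a b : ℕ) :
    {c : (Fin m ⊕ Fin m) →₀ ℕ // Finsupp.weight (bidegree m) c = (a, b)} ≃
      Sym (Fin m) a × Sym (Fin m) b :=
  ((Finsupp.sumFinsuppEquivProdFinsupp (α := Fin m) (β := Fin m) (γ := ℕ)).subtypeEquiv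
      (q := fun c => (c.1.sum fun _ => id) = a ∧ (c.2.sum fun _ => id) = b) (by
        intro c
        rw [Finsupp.weight_apply, Finsupp.sum_fintype _ _ (by simp), Fintype.sum_sum_type,
          Prod.ext_iff]
        simp [bidegree, Finsupp.sum_fintype, Prod.fst_sum, Prod.snd_sum])).trans
    ((Equiv.subtypeProdEquivProd (p := fun c : Fin m →₀ ℕ => (c.sum fun _ => id) = a)
      (q := fun c : Fin m →₀ ℕ => (c.sum fun _ => id) = b)).trans
      ((Sym.equivNatSum (Fin m) a).symm.prodCongr (Sym.equivNatSum (Fin m) b).symm))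

/-- Coordinates on the space of bihomogeneous polynomials. -/
def bihomogeneousEquiv (m a b : ℕ) :
    bihomogeneous m a b ≃ₗ[ℝ] (Sym (Fin m) a × Sym (Fin m) b →₀ ℝ) :=
  (LinearEquiv.ofEq _ _ (weightedHomogeneousSubmodule_eq_finsupp_supported ℝ (bidegree m) (a, b))).trans
    ((AddMonoidAlgebra.supportedEquivFinsupp
      {c | Finsupp.weight (bidegree m) c = (a, b)}).trans
      (Finsupp.domLCongr (bidegreeEquiv m a b)))

instance : Module.Finite ℝ (bihomogeneous m a b) :=
  Module.Finite.equiv (bihomogeneousEquiv m a b).symm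

theorem finrank_bihomogeneous (m a b : ℕ) :
    Module.finrank ℝ (bihomogeneous m a b) = m.multichoose a * m.multichoose b := by
  rw [(bihomogeneousEquiv m a b).finrank_eq, Module.finrank_finsupp_self, Fintype.card_prod,
    Sym.card_sym_eq_multichoose, Sym.card_sym_eq_multichoose, Fintype.card_fin]

/-- `raise` between bihomogeneous components. -/
def raiseMap (m a b : ℕ) : bihomogeneous m (a + 1) b →ₗ[ℝ] bihomogeneous m a (b + 1) :=
  (raise m : PhasePoly m →ₗ[ℝ] PhasePoly m).restrict fun _ h => raise_mem h

/-- `lower` between bihomogeneous components. -/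
def lowerMap (m a b : ℕ) : bihomogeneous m a (b + 1) →ₗ[ℝ] bihomogeneous m (a + 1) b :=
  (lower m : PhasePoly m →ₗ[ℝ] PhasePoly m).restrict fun _ h => lower_mem h

/-- By the previous lemma with c = 0, `raise ∘ lower` is an injective endomorphism of the
finite-dimensional space of bidegree (a, b + 1), hence surjective. -/
theorem raiseMap_surjective (h : a ≤ b) : Function.Surjective (raiseMap m a b) := by
  have hinj : Function.Injective (raiseMap m a b ∘ₗ lowerMap m a b) := by
    rw [← LinearMap.ker_eq_bot, LinearMap.ker_eq_bot']
    rintro ⟨f, hf⟩ h0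
    have h1 : raise m (lower m f) = 0 := congrArg Subtype.val h0
    have := eq_zero_of_raise_lower_eq a hf (by omega) le_rfl (by simpa using h1)
    simpa using this
  have := LinearMap.injective_iff_surjective.1 hinj
  rw [LinearMap.coe_comp] at this
  exact this.of_comp

/-- The bihomogeneous polynomials annihilated by `raise`. -/
def raiseKer (m a b : ℕ) : Submodule ℝ (PhasePoly m) :=
  bihomogeneous m a b ⊓ LinearMap.ker (raise m : PhasePoly m →ₗ[ℝ] PhasePoly m)

instance : Module.Finite ℝ (raiseKer m a b) :=
  Submodule.finiteDimensional_of_le (S₂ := bihomogeneous m a b) inf_le_left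

theorem finrank_raiseKer_zero (m b : ℕ) :
    Module.finrank ℝ (raiseKer m 0 b) = m.multichoose b := by
  have : raiseKer m 0 b = bihomogeneous m 0 b :=
    inf_eq_left.2 fun f h => raise_eq_zero h
  rw [this, finrank_bihomogeneous, Nat.multichoose_zero_right, one_mul]

theorem finrank_raiseKer_succ (m : ℕ) (h : a ≤ b) :
    Module.finrank ℝ (raiseKer m (a + 1) b) + m.multichoose a * m.multichoose (b + 1)
      = m.multichoose (a + 1) * m.multichoose b := by
  have h1 := (raiseMap m a b).finrank_range_add_finrank_ker
  rw [LinearMap.range_eq_top.2 (raiseMap_surjective h), finrank_top, finrank_bihomogeneous,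
    finrank_bihomogeneous] at h1
  have h2 : Module.finrank ℝ (LinearMap.ker (raiseMap m a b))
      = Module.finrank ℝ (raiseKer m (a + 1) b) := by
    have : raiseKer m (a + 1) b
        = (LinearMap.ker (raiseMap m a b)).map (bihomogeneous m (a + 1) b).subtype := by
      ext f
      simp only [raiseKer, Submodule.mem_inf, LinearMap.mem_ker, Submodule.mem_map]
      constructor
      · rintro ⟨h1, h2⟩
        exact ⟨⟨f, h1⟩, Subtype.ext h2, rfl⟩
      · rintro ⟨g, h1, rfl⟩
        exact ⟨g.2, congrArg Subtype.val h1⟩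
    rw [this]
    exact (LinearEquiv.finrank_eq (Submodule.equivMapOfInjective _
      (Submodule.injective_subtype _) _))
  omega

theorem sum_finrank_raiseKer (hm : 1 ≤ m) (d : ℕ) :
    ((∑ k ∈ Finset.range (d + 1), Module.finrank ℝ (raiseKer m k d) : ℕ) : ℚ)
      = killingBound m d := by
  obtain ⟨n, rfl⟩ : ∃ n, m = n + 1 := ⟨m - 1, by omega⟩
  set h := (n + 1).multichoose with hh
  -- With H k = h 0 + ... + h k = `(n + 2).multichoose k`, the partial sums are H k * h d - H (k -
  -- 1) * h (d + 1). Adding H k * h (d + 1) to both sides removes the subtractions.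
  have key : ∀ k ≤ d, (∑ j ∈ Finset.range (k + 1), Module.finrank ℝ (raiseKer (n + 1) j d))
      + (n + 2).multichoose k * h (d + 1) = (n + 2).multichoose k * h d + h k * h (d + 1) := by
    intro k
    induction k with
    | zero => intro _; simp [finrank_raiseKer_zero, hh]
    | succ k ih =>
      intro hk
      have h1 := ih (by omega)
      have h2 := finrank_raiseKer_succ (n + 1) (show k ≤ d by omega)
      rw [← hh] at h2
      rw [Finset.sum_range_succ, Nat.multichoose_succ_succ (n + 1) k, ← hh]
      linarith
  have h3 := key d le_rfl
  have hch : ∀ a b : ℕ, (((a + 1).multichoose b : ℕ) : ℚ) = (a + b)! / (a ! * b !) := by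
    intro a b
    rw [Nat.multichoose_eq, show a + 1 + b - 1 = a + b by omega, ← Nat.choose_symm_add,
      Nat.cast_add_choose]
  have h4 := congrArg (Nat.cast : ℕ → ℚ) h3
  simp only [Nat.cast_add, Nat.cast_mul, hh, hch] at h4
  rw [← eq_sub_iff_add_eq] at h4
  rw [h4, killingBound, show n + 1 + d = n + d + 1 by ring, ← add_assoc n d 1,
    Nat.add_sub_cancel, Nat.add_sub_cancel, Nat.factorial_succ (n + d), Nat.factorial_succ n,
    Nat.factorial_succ d]
  push_cast
  have := Nat.factorial_ne_zero
  field_simp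
  ring

end RelativeKilling
end

/-! ### Interpolation by finitely many values, and orders of vanishing -/

noncomputable section

namespace RelativeKilling

open MvPolynomial Set Topology

variable {m d n : ℕ}

theorem exists_homogeneous_eval {V : Type*} [AddCommMonoid V] [Module ℝ V]
    (A : MultilinearMap ℝ (fun _ : Fin n => V) ℝ) (w : Fin m → V) :
    ∃ P : MvPolynomial (Fin m) ℝ, P.IsHomogeneous n ∧
      ∀ p : Fin m → ℝ, A (fun _ => ∑ i, p i • w i) = eval p P := by
  classical
  refine ⟨∑ s : Fin n → Fin m, C (A fun i => w (s i)) * ∏ i, X (s i), ?_, fun p => ?_⟩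
  · refine IsHomogeneous.sum _ _ _ fun s _ => ?_
    have h := (isHomogeneous_C (Fin m) (A fun i => w (s i))).mul
      (IsHomogeneous.prod Finset.univ (fun i => (X (s i) : MvPolynomial (Fin m) ℝ)) (fun _ => 1)
        fun i _ => isHomogeneous_X ℝ (s i))
    simpa using h
  · rw [A.map_sum]
    simp [A.map_smul_univ, map_sum, map_prod, mul_comm]

theorem isHomogeneous_aeval {σ : Type*} {P : MvPolynomial σ ℝ} (hP : P.IsHomogeneous d)
    {Q : σ → MvPolynomial (Fin m) ℝ} (hQ : ∀ i, (Q i).IsHomogeneous 1) :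
    (aeval Q P).IsHomogeneous d := by
  have := hP.aeval Q hQ
  simpa using this

/-- Finitely many point evaluations determine a finite-dimensional space of functions, linearly. -/
theorem exists_interpolation {X : Type*} (W : Submodule ℝ (X → ℝ)) [FiniteDimensional ℝ W] :
    ∃ (s : Finset X) (B : s → W), ∀ f ∈ W, ∀ x, f x = ∑ y : s, f y * (B y : X → ℝ) x := by
  classical
  let ev : X → Module.Dual ℝ W := fun x => (LinearMap.proj x).comp W.subtype
  have hfg : (Submodule.span ℝ (range ev)).FG := IsNoetherian.noetherian _
  -- Finitely many evaluations span all of them in the dual of `W`, so their points determine a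
  -- function of `W`; a left inverse of the restriction map then supplies `B`.
  obtain ⟨t, ht, hspan⟩ := Submodule.fg_span_iff_fg_span_finset_subset _ |>.1 hfg
  rw [← image_univ, Finset.subset_set_image_iff] at ht
  obtain ⟨s, -, hs⟩ := ht
  let res : W →ₗ[ℝ] (s → ℝ) := LinearMap.pi fun y => ev y
  have hinj : LinearMap.ker res = ⊥ := by
    rw [LinearMap.ker_eq_bot']
    intro f hf
    have h1 : ∀ e ∈ Submodule.span ℝ (t : Set (Module.Dual ℝ W)), e f = 0 := by
      intro e he
      induction he using Submodule.span_induction with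
      | mem e he =>
        rw [← hs, Finset.mem_coe, Finset.mem_image] at he
        obtain ⟨y, hy, rfl⟩ := he
        exact congrFun hf ⟨y, hy⟩
      | zero => rfl
      | add _ _ _ _ h1 h2 => simp [h1, h2]
      | smul c _ _ h => simp [h]
    ext x
    have := h1 (ev x) (hspan ▸ Submodule.subset_span ⟨x, rfl⟩)
    exact this
  obtain ⟨g, hg⟩ := LinearMap.exists_leftInverse_of_injective res hinj
  refine ⟨s, fun y => g (Pi.single y 1), fun f hf x => ?_⟩
  have h2 : g (res ⟨f, hf⟩) = ⟨f, hf⟩ := LinearMap.congr_fun hg _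
  have h3 : res ⟨f, hf⟩ = ∑ y : s, f y • (Pi.single y 1 : s → ℝ) := by
    ext y
    simp [Finset.sum_apply, Pi.single_apply]
    rfl
  rw [h3, map_sum] at h2
  have h4 := congrFun (congrArg Subtype.val h2) x
  simpa [Finset.sum_apply] using h4.symm

/-- Interpolation of homogeneous polynomials by finitely many values. -/
theorem exists_homogeneous_interpolation (m d : ℕ) :
    ∃ (s : Finset (EuclideanSpace ℝ (Fin m))) (B : s → MvPolynomial (Fin m) ℝ),
      (∀ y, (B y).IsHomogeneous d) ∧
      ∀ P : MvPolynomial (Fin m) ℝ, P.IsHomogeneous d → ∀ x : EuclideanSpace ℝ (Fin m),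
        eval x P = ∑ y : s, eval y.1 P * eval x (B y) := by
  let ev : MvPolynomial (Fin m) ℝ →ₗ[ℝ] (EuclideanSpace ℝ (Fin m) → ℝ) :=
    LinearMap.pi fun x => (aeval (R := ℝ) (S₁ := ℝ) x.ofLp).toLinearMap
  have : FiniteDimensional ℝ (homogeneousSubmodule (Fin m) ℝ d) :=
    Module.Finite.iff_fg.2 (homogeneousSubmodule_fg _ _ d)
  obtain ⟨s, B, hB⟩ := exists_interpolation ((homogeneousSubmodule (Fin m) ℝ d).map ev)
  choose C hC hC' using fun y : s => (B y).2
  refine ⟨s, C, hC, fun P hP x => ?_⟩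
  have hev : ∀ Q x, ev Q x = eval x.ofLp Q := fun Q x => by
    simp [ev, aeval_eq_eval]
  have := hB (ev P) ⟨P, hP, rfl⟩ x
  simp only [← hC', hev] at this
  exact this

section Vanishing

universe u

variable {E F : Type*} [NormedAddCommGroup E] [NormedSpace ℝ E] [NormedAddCommGroup F]
  [NormedSpace ℝ F] {U : Set E} {x : E}

/-- All derivatives of order less than `n` vanish at `x`. -/
def VanishesToOrder (n : ℕ) (c : E → F) (x : E) : Prop :=
  ∀ j < n, iteratedFDeriv ℝ j c x = 0

/-- The norm form of the Leibniz rule suffices here: every summand of the upper bound is zero. -/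
theorem iteratedFDeriv_mul_eq_zero {b c : E → ℝ} (hU : IsOpen U) (hx : x ∈ U)
    (hb : ContDiffOn ℝ ∞ b U) (hc : ContDiffOn ℝ ∞ c U)
    (h : ∀ j ≤ n, iteratedFDeriv ℝ j b x = 0 ∨ iteratedFDeriv ℝ (n - j) c x = 0) :
    iteratedFDeriv ℝ n (fun q => b q * c q) x = 0 := by
  have h1 := norm_iteratedFDerivWithin_mul_le hb hc hU.uniqueDiffOn hx (n := n)
    (by exact_mod_cast le_top)
  rw [Finset.sum_eq_zero, norm_le_zero_iff, iteratedFDerivWithin_of_isOpen n hU hx] at h1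
  · exact h1
  · intro j hj
    rw [iteratedFDerivWithin_of_isOpen _ hU hx, iteratedFDerivWithin_of_isOpen _ hU hx]
    rcases h j (by simpa [Nat.lt_succ_iff] using hj) with h | h <;> simp [h]

theorem VanishesToOrder.mul {b c : E → ℝ} (hU : IsOpen U) (hx : x ∈ U)
    (hb : ContDiffOn ℝ ∞ b U) (hc : ContDiffOn ℝ ∞ c U) (h : VanishesToOrder n c x) :
    VanishesToOrder n (fun q => b q * c q) x := fun j hj =>
  iteratedFDeriv_mul_eq_zero hU hx hb hc fun i _ => .inr (h _ (by omega))

/-- Split b into b - b x and the constant b x. The first factor vanishes at x, so its product with c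
vanishes to one order more. -/
theorem VanishesToOrder.iteratedFDeriv_mul {b c : E → ℝ} (hU : IsOpen U) (hx : x ∈ U)
    (hb : ContDiffOn ℝ ∞ b U) (hc : ContDiffOn ℝ ∞ c U) (h : VanishesToOrder n c x) :
    iteratedFDeriv ℝ n (fun q => b q * c q) x = b x • iteratedFDeriv ℝ n c x := by
  have hb' : ContDiffOn ℝ ∞ (fun q => b q - b x) U := hb.sub contDiffOn_const
  have h1 : iteratedFDeriv ℝ n (fun q => (b q - b x) * c q) x = 0 := by
    refine iteratedFDeriv_mul_eq_zero hU hx hb' hc fun i _ => ?_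
    rcases Nat.eq_zero_or_pos i with rfl | hi
    · left
      ext v
      simp
    · rcases Nat.eq_zero_or_pos n with rfl | hn
      · omega
      · exact .inr (h _ (by omega))
  have h2 : (fun q => b q * c q) = (fun q => (b q - b x) * c q) + fun q => b x • c q := by
    ext q; simp; ring
  have hat : ∀ {f : E → ℝ}, ContDiffOn ℝ ∞ f U → ContDiffAt ℝ n f x := fun hf =>
    (hf.contDiffAt (hU.mem_nhds hx)).of_le (by exact_mod_cast le_top)
  rw [h2, iteratedFDeriv_add_apply (hat (hb'.mul hc)) (hat (hc.const_smul _)), h1, zero_add]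
  exact iteratedFDeriv_const_smul_apply (R := ℝ) (a := b x) (hat hc)

theorem iteratedFDeriv_fderiv_apply {c : E → ℝ} (hU : IsOpen U) (hx : x ∈ U)
    (hc : ContDiffOn ℝ ∞ c U) (v : E) (w : Fin n → E) :
    iteratedFDeriv ℝ n (fun q => fderiv ℝ c q v) x w
      = iteratedFDeriv ℝ (n + 1) c x (Fin.snoc w v) := by
  have hat : ContDiffAt ℝ n (fderiv ℝ c) x :=
    (hc.contDiffAt (hU.mem_nhds hx)).fderiv_right (by exact_mod_cast le_top)
  have := (ContinuousLinearMap.apply ℝ ℝ v).iteratedFDeriv_comp_left hat (i := n) le_rfl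
  rw [iteratedFDeriv_succ_apply_right, Fin.snoc_last, Fin.init_snoc]
  exact congrArg (fun A => A w) this

theorem VanishesToOrder.fderiv_apply {c : E → ℝ} (hU : IsOpen U) (hx : x ∈ U)
    (hc : ContDiffOn ℝ ∞ c U) (h : VanishesToOrder (n + 1) c x) (v : E) :
    VanishesToOrder n (fun q => fderiv ℝ c q v) x := fun j hj => by
  ext w
  rw [iteratedFDeriv_fderiv_apply hU hx hc, h _ (by omega)]
  rfl

/-- Taylor's bound by induction: apply it to `fderiv ℝ c`, then the mean value inequality on the
ball of radius ‖q - x‖. The induction replaces F by E →L[ℝ] F, which is why both live in one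
universe. -/
theorem VanishesToOrder.isBigO {E : Type u} [NormedAddCommGroup E] [NormedSpace ℝ E] {x : E}
    (n : ℕ) : ∀ {F : Type u} [NormedAddCommGroup F] [NormedSpace ℝ F]
    {c : E → F} (_ : ContDiffAt ℝ ∞ c x) (_ : VanishesToOrder n c x),
    c =O[𝓝 x] fun q => ‖q - x‖ ^ n := by
  induction n with
  | zero =>
    intro F _ _ c hc _
    simpa using hc.continuousAt.isBigO_one ℝ
  | succ n ih =>
    intro F _ _ c hc h
    have h1 : VanishesToOrder n (fderiv ℝ c) x := fun j hj => by
      have := h (j + 1) (by omega)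
      rw [← norm_eq_zero, ← norm_iteratedFDeriv_fderiv, norm_eq_zero] at this
      exact this
    obtain ⟨C, hC⟩ := (ih (hc.fderiv_right (m := ∞) le_rfl) h1).bound
    have hd : ∀ᶠ q in 𝓝 x, DifferentiableAt ℝ c q :=
      ((hc.of_le (m := 1) (by exact_mod_cast le_top)).eventually (by simp)).mono
        fun q hq => hq.differentiableAt (by simp)
    obtain ⟨r, hr, hball⟩ := Metric.eventually_nhds_iff_ball.1 (hC.and hd)
    have h0 : c x = 0 := by
      have := h 0 (by omega)
      have := congrArg (fun A => A 0) this
      simpa using this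
    refine Asymptotics.IsBigO.of_bound C ?_
    filter_upwards [Metric.ball_mem_nhds x hr] with q hq
    have hsub : Metric.closedBall x ‖q - x‖ ⊆ Metric.ball x r :=
      Metric.closedBall_subset_ball (by simpa [dist_eq_norm] using hq)
    have := (convex_closedBall x ‖q - x‖).norm_image_sub_le_of_norm_fderiv_le (𝕜 := ℝ)
      (C := C * ‖q - x‖ ^ n) (fun y hy => (hball y (hsub hy)).2) (fun y hy => ?_)
      (Metric.mem_closedBall_self (norm_nonneg _))
      (by simp [dist_eq_norm] : q ∈ Metric.closedBall x ‖q - x‖)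
    · rw [h0, sub_zero] at this
      refine this.trans (le_of_eq ?_)
      rw [norm_pow, norm_norm, pow_succ, mul_assoc]
    · refine (hball y (hsub hy)).1.trans ?_
      -- The constant of the asymptotic bound comes without a sign; it can be negative only if the
      -- right side is zero.
      have hC0 : 0 ≤ C ∨ ‖q - x‖ ^ n = 0 := by
        by_contra! hcon
        have := (norm_nonneg _).trans (hball q hq).1
        rw [norm_pow, norm_norm] at this
        have hp : 0 < ‖q - x‖ ^ n := lt_of_le_of_ne (by positivity) (Ne.symm hcon.2)
        nlinarith
      have hyq : ‖y - x‖ ≤ ‖q - x‖ := by simpa [dist_eq_norm] using hy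
      rw [norm_pow, norm_norm]
      rcases hC0 with hC0 | hC0
      · gcongr
      · have hn : n ≠ 0 := by rintro rfl; simp at hC0
        have hq0 : ‖q - x‖ = 0 := by simpa [hn] using hC0
        have hy0 : ‖y - x‖ = 0 := le_antisymm (hq0 ▸ hyq) (norm_nonneg _)
        rw [hq0, hy0]

end Vanishing

end RelativeKilling
end

/-! ### Leading parts of transported forms -/

noncomputable section

namespace RelativeKilling

open MvPolynomial Set Topology

variable {m d n : ℕ}

/-- The part of the symmetry of higher derivatives that is needed: one distinguished vector may be
moved to the last slot. By induction it reaches the last slot but one, and symmetry of second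
derivatives does the final exchange. -/
theorem iteratedFDeriv_update_const {E : Type*} [NormedAddCommGroup E] [NormedSpace ℝ E]
    {U : Set E} {x : E} (hU : IsOpen U) (hx : x ∈ U) (n : ℕ) :
    ∀ {c : E → ℝ} (_ : ContDiffOn ℝ ∞ c U) (h v : E) (i : Fin (n + 1)),
      iteratedFDeriv ℝ (n + 1) c x (Function.update (fun _ => h) i v)
        = iteratedFDeriv ℝ (n + 1) c x (Fin.snoc (fun _ => h) v) := by
  have hlast : ∀ (n : ℕ) (h v : E), Function.update (fun _ : Fin (n + 1) => h) (Fin.last n) v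
      = Fin.snoc (fun _ => h) v := by
    intro n h v
    ext j
    refine Fin.lastCases ?_ (fun j => ?_) j
    · simp
    · simp
  induction n with
  | zero =>
    intro c hc h v i
    obtain rfl : i = Fin.last 0 := by omega
    rw [hlast]
  | succ n ih =>
    intro c hc h v i
    refine Fin.lastCases ?_ (fun i => ?_) i
    · rw [hlast]
    · have h1 : Function.update (fun _ : Fin (n + 1 + 1) => h) i.castSucc v
          = Fin.snoc (Function.update (fun _ : Fin (n + 1) => h) i v) h := by
        ext j
        refine Fin.lastCases ?_ (fun j => ?_) j
        · simp [Function.update_of_ne (Fin.castSucc_lt_last i).ne']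
        · by_cases hj : j = i
          · subst hj; simp
          · simp [Function.update_of_ne hj,
              Function.update_of_ne ((Fin.castSucc_injective _).ne hj)]
      have h2 : (fun _ : Fin (n + 1) => h) = Fin.snoc (fun _ : Fin n => h) h := by
        rw [← hlast]; simp
      have hd : ∀ u : E, ContDiffOn ℝ ∞ (fun q => fderiv ℝ c q u) U := fun u =>
        (hc.fderiv_of_isOpen hU (m := ∞) le_rfl).clm_apply contDiffOn_const
      rw [h1, ← iteratedFDeriv_fderiv_apply hU hx hc, ih (hd h),
        ← iteratedFDeriv_fderiv_apply hU hx (hd h), ← iteratedFDeriv_fderiv_apply hU hx hc, h2,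
        ← iteratedFDeriv_fderiv_apply hU hx (hd v)]
      have heq : (fun q => fderiv ℝ (fun q' => fderiv ℝ c q' h) q v)
          =ᶠ[𝓝 x] fun q => fderiv ℝ (fun q' => fderiv ℝ c q' v) q h := by
        filter_upwards [hU.mem_nhds hx] with q hq
        have hcq := hc.contDiffAt (hU.mem_nhds hq)
        have hdq : DifferentiableAt ℝ (fderiv ℝ c) q :=
          (hcq.fderiv_right (m := 1) (by norm_cast)).differentiableAt (by simp)
        rw [fderiv_clm_apply hdq (differentiableAt_const _),
          fderiv_clm_apply hdq (differentiableAt_const _)]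
        have := hcq.isSymmSndFDerivAt
          (by simp only [minSmoothness_of_isRCLikeNormedField]; norm_cast) v h
        simpa using this
      rw [(heq.iteratedFDeriv ℝ _).eq_of_nhds]

/-- The positions-and-momenta coordinate space. -/
abbrev Coord (m : ℕ) : Type := EuclideanSpace ℝ (Fin m)

/-- A smooth function `k(q, p)` on `U × ℝᵐ` that is a homogeneous polynomial of degree `d`
in `p`. -/
structure SmoothForm (d : ℕ) (U : Set (Coord m)) (k : Coord m → Coord m → ℝ) : Prop where
  smooth : ContDiffOn ℝ ∞ (fun z : Coord m × Coord m => k z.1 z.2) (U ×ˢ univ)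
  homogeneous : ∀ q ∈ U, ∃ P : MvPolynomial (Fin m) ℝ, P.IsHomogeneous d ∧
    ∀ p : Coord m, k q p = eval p.ofLp P

/-- A second-order vector field `(A(q) p, b(q, p))` on `U × ℝᵐ`, quadratic in the momenta, whose
position part is nondegenerate. -/
structure GeodesicField (U : Set (Coord m)) (A : Coord m → Coord m →L[ℝ] Coord m)
    (b : Coord m → Coord m → Coord m) : Prop where
  isOpen : IsOpen U
  smooth_fst : ContDiffOn ℝ ∞ A U
  smooth_snd : ContDiffOn ℝ ∞ (fun z : Coord m × Coord m => b z.1 z.2) (U ×ˢ univ)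
  bijective : ∀ q ∈ U, Function.Bijective (A q)
  quadratic : ∀ q ∈ U, ∀ (s : ℝ) p, b q (s • p) = s ^ 2 • b q p

/-- The function `k` is multiplied by `l` under differentiation along the field `(A(q) p, b)`. -/
def IsTransported (U : Set (Coord m)) (A : Coord m → Coord m →L[ℝ] Coord m)
    (b : Coord m → Coord m → Coord m) (l k : Coord m → Coord m → ℝ) : Prop :=
  ∀ q ∈ U, ∀ p, fderiv ℝ (fun q' => k q' p) q (A q p) + fderiv ℝ (k q) p (b q p) = l q p * k q p

theorem contDiffOn_left {F : Type*} [NormedAddCommGroup F] [NormedSpace ℝ F] {U : Set (Coord m)}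
    {f : Coord m → Coord m → F}
    (h : ContDiffOn ℝ ∞ (fun z : Coord m × Coord m => f z.1 z.2) (U ×ˢ univ)) (p : Coord m) :
    ContDiffOn ℝ ∞ (fun q => f q p) U :=
  h.comp (f := fun q : Coord m => (q, p)) (by fun_prop) fun _ hq => ⟨hq, mem_univ _⟩

theorem contDiff_eval (P : MvPolynomial (Fin m) ℝ) :
    ContDiff ℝ ∞ fun p : Coord m => eval p.ofLp P := by
  induction P using MvPolynomial.induction_on with
  | C a => simpa using contDiff_const
  | add P Q hP hQ => simpa using hP.add hQ
  | mul_X P i hP =>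
    simp only [map_mul, eval_X]
    exact hP.mul (by fun_prop)

/-- The leading part at `x` of a form that vanishes to order `n` there. -/
def leadingPart (n : ℕ) (k : Coord m → Coord m → ℝ) (x h p : Coord m) : ℝ :=
  iteratedFDeriv ℝ n (fun q => k q p) x fun _ => h

section

variable {U : Set (Coord m)} {A : Coord m → Coord m →L[ℝ] Coord m}
  {b : Coord m → Coord m → Coord m} {l k : Coord m → Coord m → ℝ} {x : Coord m}

/-- Interpolation separates the variables: k(q, p) = ∑ k(q, y) P_y(p) over finitely many fixed
momenta y. Position derivatives act on k(·, y) alone and give a form of degree n in h, while P_y(B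
v) has degree d in v. -/
theorem leadingPart_bihomogeneous (hU : IsOpen U) (hk : SmoothForm d U k) (hx : x ∈ U) (n : ℕ)
    (B : Coord m →L[ℝ] Coord m) :
    ∃ Q ∈ bihomogeneous m n d, ∀ h v : Coord m,
      leadingPart n k x h (B v) = eval (Sum.elim h.ofLp v.ofLp) Q := by
  classical
  obtain ⟨s, P, hP, hint⟩ := exists_homogeneous_interpolation m d
  have hat : ∀ p, ContDiffAt ℝ n (fun q => k q p) x := fun p =>
    ((contDiffOn_left hk.smooth p).contDiffAt (hU.mem_nhds hx)).of_le (by exact_mod_cast le_top)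
  have hsum : ∀ p, (fun q => k q p) =ᶠ[𝓝 x] fun q => ∑ y : s, eval p.ofLp (P y) • k q y := by
    intro p
    filter_upwards [hU.mem_nhds hx] with q hq
    obtain ⟨R, hR, hkR⟩ := hk.homogeneous q hq
    simp only [hkR, smul_eq_mul]
    rw [hint R hR p]
    simp only [mul_comm]
  have hlead : ∀ h p, leadingPart n k x h p
      = ∑ y : s, eval p.ofLp (P y) * leadingPart n k x h y := by
    intro h p
    rw [leadingPart, ((hsum p).iteratedFDeriv ℝ _).eq_of_nhds, iteratedFDeriv_fun_sum_apply
      (f := fun (y : s) q => eval p.ofLp (P y) • k q y) fun y _ => (hat y).const_smul _, sum_apply]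
    refine Finset.sum_congr rfl fun y _ => ?_
    rw [iteratedFDeriv_const_smul_apply' (hat y)]
    rfl
  have hpos : ∀ y : s, ∃ R : MvPolynomial (Fin m) ℝ, R.IsHomogeneous n ∧
      ∀ h : Coord m, leadingPart n k x h y = eval h.ofLp R := by
    intro y
    obtain ⟨R, hR, hev⟩ := exists_homogeneous_eval
      (iteratedFDeriv ℝ n (fun q => k q y) x).toMultilinearMap (stdVec (m := m))
    refine ⟨R, hR, fun h => ?_⟩
    rw [← hev, leadingPart]
    have : h = ∑ i, h.ofLp i • stdVec i := by
      ext j; simp [stdVec, Pi.single_apply]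
    conv_lhs => rw [this]
    rfl
  choose R hR hevR using hpos
  let lin : Fin m → MvPolynomial (Fin m) ℝ := fun i => ∑ j, C ((B (stdVec j)).ofLp i) * X j
  have hlin : ∀ i, (lin i).IsHomogeneous 1 := fun i => IsHomogeneous.sum _ _ _ fun j _ => by
    simpa using (isHomogeneous_C (Fin m) ((B (stdVec j)).ofLp i)).mul (isHomogeneous_X ℝ j)
  have hevlin : ∀ (v : Coord m) i, eval v.ofLp (lin i) = (B v).ofLp i := by
    intro v i
    have : v = ∑ i, v.ofLp i • stdVec i := by
      ext j; simp [stdVec, Pi.single_apply]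
    conv_rhs => rw [this]
    simp [lin, mul_comm]
  have hrename : ∀ {N : ℕ} {T : MvPolynomial (Fin m) ℝ} (f : Fin m → Fin m ⊕ Fin m) (w : ℕ × ℕ),
      (∀ i, bidegree m (f i) = w) → T.IsHomogeneous N →
      (rename f T).IsWeightedHomogeneous (bidegree m) (N • w) := by
    intro N T f w hf hT
    rw [T.as_sum, map_sum]
    refine IsWeightedHomogeneous.sum _ _ _ fun c hc => ?_
    rw [rename_monomial]
    refine isWeightedHomogeneous_monomial _ _ _ ?_
    rw [← hT (mem_support_iff.1 hc), Finsupp.weight_apply, Finsupp.weight_apply,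
      Finsupp.sum_mapDomain_index (by simp) (by simp [add_smul]), Finsupp.sum, Finsupp.sum,
      Finset.sum_smul]
    simp [hf]
  refine ⟨∑ y : s, rename .inr (aeval lin (P y)) * rename .inl (R y), ?_, fun h v => ?_⟩
  · refine Submodule.sum_mem _ fun y _ => ?_
    have h1 := hrename (.inr : Fin m → Fin m ⊕ Fin m) (0, 1) (fun _ => rfl)
      (isHomogeneous_aeval (hP y) hlin)
    have h2 := hrename (.inl : Fin m → Fin m ⊕ Fin m) (1, 0) (fun _ => rfl) (hR y)
    rw [mem_weightedHomogeneousSubmodule]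
    simpa using h1.mul h2
  · rw [hlead, map_sum]
    refine Finset.sum_congr rfl fun y _ => ?_
    rw [map_mul, eval_rename, eval_rename, Sum.elim_comp_inr, Sum.elim_comp_inl, ← hevR]
    congr 1
    have hcomp : (aeval v.ofLp).comp (aeval lin) = aeval (R := ℝ) (B v).ofLp := by
      rw [comp_aeval]
      exact congrArg aeval (funext fun i => by simpa using hevlin v i)
    simpa using (DFunLike.congr_fun hcomp (P y)).symm

/-- `raise` is differentiation of the position in the direction of the velocity; this links the
algebra to the derivatives of leading parts. -/
theorem hasDerivAt_eval_raise (Q : PhasePoly m) (h v : Fin m → ℝ) :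
    HasDerivAt (fun t : ℝ => eval (Sum.elim (h + t • v) v) Q)
      (eval (Sum.elim h v) (raise m Q)) 0 := by
  induction Q using MvPolynomial.induction_on with
  | C a => simpa [derivation_C] using hasDerivAt_const (0 : ℝ) a
  | add P Q hP hQ => simpa only [map_add] using hP.fun_add hQ
  | mul_X P i hP =>
    have hX : HasDerivAt (fun t : ℝ => eval (Sum.elim (h + t • v) v) (X i))
        (eval (Sum.elim h v) (raise m (X i))) 0 := by
      classical
      rcases i with i | i
      · simpa [raise_apply, pderiv_X, Pi.single_apply] using
          ((hasDerivAt_id (0 : ℝ)).mul_const (v i)).const_add (h i)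
      · simpa [raise_apply, pderiv_X, Pi.single_apply] using hasDerivAt_const (0 : ℝ) (v i)
    have := hP.mul hX
    simp only [map_mul, Derivation.leibniz, smul_eq_mul, map_add]
    convert! this using 1
    simp
    ring

/-- Differentiate the transport equation n times at x. The terms in l and b multiply functions
vanishing to order n + 1 and drop out; in the remaining one all derivatives must fall on k, with the
coefficient A frozen at x. -/
theorem iteratedFDeriv_snoc_eq_zero (hG : GeodesicField U A b) (hk : SmoothForm d U k)
    (hl : ContDiffOn ℝ ∞ (fun z : Coord m × Coord m => l z.1 z.2) (U ×ˢ univ))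
    (ht : IsTransported U A b l k) (hx : x ∈ U)
    (hv : ∀ p, VanishesToOrder (n + 1) (fun q => k q p) x) (h p : Coord m) :
    iteratedFDeriv ℝ (n + 1) (fun q => k q p) x (Fin.snoc (fun _ => h) (A x p)) = 0 := by
  classical
  have hU := hG.isOpen
  obtain ⟨s, P, hP, hint⟩ := exists_homogeneous_interpolation m d
  have hkp : ∀ p, ContDiffOn ℝ ∞ (fun q => k q p) U := contDiffOn_left hk.smooth
  have hd : ∀ u : Coord m, ContDiffOn ℝ ∞ (fun q => fderiv ℝ (fun q' => k q' p) q u) U := fun u =>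
    ((hkp p).fderiv_of_isOpen hU (m := ∞) le_rfl).clm_apply contDiffOn_const
  have hA : ∀ i, ContDiffOn ℝ ∞ (fun q => (A q p).ofLp i) U := fun i =>
    ((EuclideanSpace.proj i : Coord m →L[ℝ] ℝ).contDiff.comp_contDiffOn
      (hG.smooth_fst.clm_apply contDiffOn_const))
  have hsnd : ∀ y : s, ContDiffOn ℝ ∞
      (fun q => fderiv ℝ (fun p' : Coord m => eval p'.ofLp (P y)) p (b q p)) U := fun y =>
    (fderiv ℝ (fun p' : Coord m => eval p'.ofLp (P y)) p).contDiff.comp_contDiffOn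
      (contDiffOn_left hG.smooth_snd p)
  have hlp : ContDiffOn ℝ ∞ (fun q => l q p) U := contDiffOn_left hl p
  have hexp : ∀ u : Coord m, u = ∑ i, u.ofLp i • stdVec i := fun u => by
    ext j; simp [stdVec, Pi.single_apply]
  -- Interpolation rewrites the momentum derivative of k through the values k(q, y), so that the
  -- vanishing hypothesis applies to it.
  have heq : (fun q => ∑ i, (A q p).ofLp i * fderiv ℝ (fun q' => k q' p) q (stdVec i))
      =ᶠ[𝓝 x] fun q => l q p * k q p
        + ∑ y : s, -fderiv ℝ (fun p' : Coord m => eval p'.ofLp (P y)) p (b q p) * k q y := by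
    filter_upwards [hU.mem_nhds hx] with q hq
    obtain ⟨R, hR, hkR⟩ := hk.homogeneous q hq
    have h1 : k q = fun p' => ∑ y : s, k q y * eval p'.ofLp (P y) := by
      ext p'
      simp only [hkR]
      exact hint R hR p'
    have h2 : fderiv ℝ (k q) p
        = ∑ y : s, k q y • fderiv ℝ (fun p' : Coord m => eval p'.ofLp (P y)) p := by
      have hdiff : ∀ y : s, DifferentiableAt ℝ (fun p' : Coord m => eval p'.ofLp (P y)) p :=
        fun y => (contDiff_eval (P y)).differentiable (by simp) p
      conv_lhs => rw [h1]
      rw [fderiv_fun_sum fun y _ => (hdiff y).const_mul _]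
      exact Finset.sum_congr rfl fun y _ => fderiv_const_mul (hdiff y) _
    have h3 := ht q hq p
    rw [h2] at h3
    conv_lhs at h3 => rw [hexp (A q p)]
    rw [← h3]
    simp [mul_comm]
  have hat : ∀ {f : Coord m → ℝ}, ContDiffOn ℝ ∞ f U → ContDiffAt ℝ n f x := fun hf =>
    (hf.contDiffAt (hU.mem_nhds hx)).of_le (by exact_mod_cast le_top)
  have hR : iteratedFDeriv ℝ n (fun q => l q p * k q p
      + ∑ y : s, -fderiv ℝ (fun p' : Coord m => eval p'.ofLp (P y)) p (b q p) * k q y) x = 0 := by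
    have h1 := (hv p).mul hU hx hlp (hkp p) n (by omega)
    have h2 := fun y : s => (hv y).mul hU hx (hsnd y).neg (hkp y) n (by omega)
    have := iteratedFDeriv_add_apply (hat (hlp.mul (hkp p)))
      (hat (ContDiffOn.sum fun (y : s) (_ : y ∈ Finset.univ) => (hsnd y).neg.mul (hkp y)))
    refine this.trans ?_
    rw [h1, iteratedFDeriv_fun_sum_apply fun y _ => hat ((hsnd y).neg.mul (hkp y)), zero_add]
    exact Finset.sum_eq_zero fun y _ => h2 y
  rw [← (heq.iteratedFDeriv ℝ _).eq_of_nhds, iteratedFDeriv_fun_sum_apply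
    fun i _ => hat ((hA i).mul (hd _))] at hR
  have hL := fun i : Fin m => ((hv p).fderiv_apply hU hx (hkp p) (stdVec i)).iteratedFDeriv_mul
    hU hx (hA i) (hd _)
  simp only [hL] at hR
  have hR' := congrArg (fun T => T fun _ => h) hR
  simp only [sum_apply, smul_apply,
    iteratedFDeriv_fderiv_apply hU hx (hkp p)] at hR'
  rw [iteratedFDeriv_succ_apply_right, Fin.snoc_last, Fin.init_snoc]
  conv_lhs => rw [hexp (A x p)]
  rw [map_sum]
  simp only [iteratedFDeriv_succ_apply_right, Fin.snoc_last, Fin.init_snoc] at hR'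
  simpa using hR'

theorem leadingPart_mem_raiseKer (hG : GeodesicField U A b) (hk : SmoothForm d U k)
    (hl : ContDiffOn ℝ ∞ (fun z : Coord m × Coord m => l z.1 z.2) (U ×ˢ univ))
    (ht : IsTransported U A b l k) (hx : x ∈ U)
    (hv : ∀ p, VanishesToOrder n (fun q => k q p) x) {B : Coord m →L[ℝ] Coord m}
    (hB : ∀ v, A x (B v) = v) :
    ∃ Q ∈ raiseKer m n d, ∀ h v : Coord m,
      leadingPart n k x h (B v) = eval (Sum.elim h.ofLp v.ofLp) Q := by
  classical
  obtain ⟨Q, hQ, hlead⟩ := leadingPart_bihomogeneous hG.isOpen hk hx n B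
  refine ⟨Q, ⟨hQ, ?_⟩, hlead⟩
  change raise m Q = 0
  rcases n with _ | n
  · exact raise_eq_zero hQ
  refine MvPolynomial.funext fun z => ?_
  obtain ⟨h, v, rfl⟩ : ∃ h v : Coord m, z = Sum.elim h.ofLp v.ofLp :=
    ⟨.toLp 2 (z ∘ .inl), .toLp 2 (z ∘ .inr), by ext (i | i) <;> simp⟩
  rw [map_zero]
  have h1 := hasDerivAt_eval_raise Q h.ofLp v.ofLp
  refine h1.unique ?_
  have h2 : HasDerivAt (fun t : ℝ => leadingPart (n + 1) k x (h + t • v) (B v)) 0 0 := by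
    have hline : HasDerivAt (fun (t : ℝ) (_ : Fin (n + 1)) => h + t • v) (fun _ => v) 0 := by
      rw [hasDerivAt_pi]
      intro i
      simpa using ((hasDerivAt_id (0 : ℝ)).smul_const v).const_add h
    have h3 := ((iteratedFDeriv ℝ (n + 1) (fun q => k q (B v)) x).hasFDerivAt
      (fun _ : Fin (n + 1) => h + (0 : ℝ) • v)).comp_hasDerivAt (0 : ℝ) hline
    convert! h3 using 1
    -- The derivative is a sum over slots with one vector replaced by v. Each term equals the one
    -- with v in the last slot, which is zero because v = A x (B v).
    rw [ContinuousMultilinearMap.linearDeriv_apply]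
    symm
    refine Finset.sum_eq_zero fun i _ => ?_
    rw [iteratedFDeriv_update_const hG.isOpen hx n (contDiffOn_left hk.smooth _)]
    conv_lhs => rw [← hB v]
    rw [hB]
    have := iteratedFDeriv_snoc_eq_zero hG hk hl ht hx hv (h + (0 : ℝ) • v) (B v)
    rwa [hB] at this
  convert! h2 using 1
  ext t
  rw [hlead]
  rfl

end

end RelativeKilling
end

/-! ### Flow near an equilibrium and Grönwall estimates -/

noncomputable section

namespace RelativeKilling

open MvPolynomial Set Topology Metric
open scoped NNReal

variable {m d n : ℕ}

section Flow

variable {V : Type*} [NormedAddCommGroup V] [NormedSpace ℝ V]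

theorem hasDerivWithinAt_Ici_of_Icc {f : ℝ → V} {f' : V} {t τ : ℝ} (ht : t ∈ Ico 0 τ)
    (h : HasDerivWithinAt f f' (Icc 0 τ) t) : HasDerivWithinAt f f' (Ici t) t :=
  h.mono_of_mem_nhdsWithin (Icc_mem_nhdsGE_of_mem ht)

theorem exp_le_one_add_two_mul {x : ℝ} (h0 : 0 ≤ x) (h1 : x ≤ 1 / 2) : Real.exp x ≤ 1 + 2 * x := by
  have := Real.abs_exp_sub_one_le (x := x) (by rw [abs_of_nonneg h0]; linarith)
  rw [abs_of_nonneg h0] at this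
  linarith [(abs_le.1 this).2]

/-- The flow near an equilibrium `z₀` of a vector field with linear part `N`, for a time `τ` that
depends on `N` only. -/
theorem exists_flow_near_equilibrium [CompleteSpace V] {X : V → V} {N : V →L[ℝ] V} {z₀ : V}
    {τ : ℝ} {η : ℝ≥0}
    (hX : HasStrictFDerivAt X N z₀) (h0 : X z₀ = 0) (hη : 0 < η) (hτ : 0 < τ)
    (hτη : τ * (‖N‖ + η) ≤ 1 / 2) {W : Set V} (hW : W ∈ 𝓝 z₀) :
    ∃ a > 0, closedBall z₀ a ⊆ W ∧ ApproximatesLinearOn X N (closedBall z₀ a) η ∧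
      ∃ F : V → ℝ → V,
        (∀ z ∈ closedBall z₀ (a / 2), F z 0 = z ∧ ∀ t ∈ Icc 0 τ, F z t ∈ closedBall z₀ a ∧
          HasDerivWithinAt (F z) (X (F z t)) (Icc 0 τ) t) ∧
        (∀ z ∈ closedBall z₀ (a / 2), ∀ z' ∈ closedBall z₀ (a / 2), ∀ t ∈ Icc 0 τ,
          ‖F z t - F z' t‖ ≤ 2 * ‖z - z'‖) ∧
        ∀ z ∈ closedBall z₀ (a / 2), X z = 0 → ∀ t ∈ Icc 0 τ, F z t = z := by
  obtain ⟨s, hs, happ⟩ := hX.approximates_deriv_on_nhds (c := η) (.inr hη)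
  obtain ⟨a, ha, has⟩ := nhds_basis_closedBall.mem_iff.1 (Filter.inter_mem hs hW)
  have happ' : ApproximatesLinearOn X N (closedBall z₀ a) η :=
    happ.mono_set (has.trans inter_subset_left)
  have hlip : LipschitzOnWith (‖N‖₊ + η) X (closedBall z₀ a) := by
    have := happ'.lipschitz
    exact lipschitzOnWith_iff_restrict.2 this
  refine ⟨a, ha, has.trans inter_subset_right, happ', ?_⟩
  -- As X z₀ = 0, the speed is at most (‖N‖ + η) a. Starting within a / 2, a solution stays in the
  -- ball up to time τ, whatever a is.
  have hbd : ∀ z ∈ closedBall z₀ a, ‖X z‖ ≤ ((‖N‖₊ + η) * a.toNNReal : ℝ≥0) := by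
    intro z hz
    have := hlip.dist_le_mul z hz z₀ (mem_closedBall_self ha.le)
    rw [dist_eq_norm, h0, sub_zero] at this
    refine this.trans ?_
    push_cast
    rw [Real.coe_toNNReal a ha.le]
    gcongr
    exact hz
  have hPL : IsPicardLindelof (fun _ => X) (⟨0, left_mem_Icc.2 hτ.le⟩ : Icc (0 : ℝ) τ) z₀
      a.toNNReal (a / 2).toNNReal ((‖N‖₊ + η) * a.toNNReal) (‖N‖₊ + η) := by
    have hca : (a.toNNReal : ℝ) = a := Real.coe_toNNReal a ha.le
    have hca2 : ((a / 2).toNNReal : ℝ) = a / 2 := Real.coe_toNNReal _ (by linarith)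
    refine .of_time_independent ?_ ?_ ?_
    · rwa [hca]
    · rwa [hca]
    · push_cast
      rw [hca, hca2, sub_zero, sub_self, max_eq_left hτ.le]
      nlinarith
  have hsol : ∀ z ∈ closedBall z₀ (a / 2), ∃ f : ℝ → V, f 0 = z ∧ ∀ t ∈ Icc 0 τ,
      f t ∈ closedBall z₀ a ∧ HasDerivWithinAt f (X (f t)) (Icc 0 τ) t := by
    intro z hz
    have hz' : z ∈ closedBall z₀ ((a / 2).toNNReal : ℝ) := by
      rwa [Real.coe_toNNReal _ (by linarith)]
    -- The Picard fixed point itself is used, since it carries the proof that it stays in the ball.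
    obtain ⟨α, hα⟩ := ODE.FunSpace.exists_isFixedPt_next hPL hz'
    have hmem : ∀ t, α.compProj t ∈ closedBall z₀ a := fun t => by
      have := α.compProj_mem_closedBall hPL.mul_max_le (t := t)
      rwa [Real.coe_toNNReal a ha.le] at this
    refine ⟨α.compProj, ?_, fun t ht => ⟨hmem t, ?_⟩⟩
    · exact (ODE.FunSpace.compProj_val (t := ⟨0, left_mem_Icc.2 hτ.le⟩)).trans
        (by rw [← hα, ODE.FunSpace.next_apply₀])
    · apply ODE.hasDerivWithinAt_picard_Icc (left_mem_Icc.2 hτ.le) hPL.continuousOn_uncurry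
        α.continuous_compProj.continuousOn
        (fun _ _ => α.compProj_mem_closedBall hPL.mul_max_le) z ht |>.congr_of_mem _ ht
      intro t' ht'
      nth_rw 1 [← hα]
      rw [ODE.FunSpace.compProj_of_mem ht', ODE.FunSpace.next_apply]
  have hdist : ∀ f g : ℝ → V, (∀ t ∈ Icc 0 τ, f t ∈ closedBall z₀ a ∧
      HasDerivWithinAt f (X (f t)) (Icc 0 τ) t) → (∀ t ∈ Icc 0 τ, g t ∈ closedBall z₀ a ∧
      HasDerivWithinAt g (X (g t)) (Icc 0 τ) t) → ∀ t ∈ Icc 0 τ,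
      ‖f t - g t‖ ≤ 2 * ‖f 0 - g 0‖ := by
    intro f g hf hg t ht
    have h1 := dist_le_of_trajectories_ODE_of_mem (v := fun _ => X) (s := fun _ => closedBall z₀ a)
      (K := ‖N‖₊ + η) (f := f) (g := g) (a := 0) (b := τ) (fun _ _ => hlip)
      (fun t ht => (hf t ht).2.continuousWithinAt)
      (fun t ht => hasDerivWithinAt_Ici_of_Icc ht (hf t (Ico_subset_Icc_self ht)).2)
      (fun t ht => (hf t (Ico_subset_Icc_self ht)).1)
      (fun t ht => (hg t ht).2.continuousWithinAt)
      (fun t ht => hasDerivWithinAt_Ici_of_Icc ht (hg t (Ico_subset_Icc_self ht)).2)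
      (fun t ht => (hg t (Ico_subset_Icc_self ht)).1) le_rfl t ht
    rw [dist_eq_norm, dist_eq_norm, sub_zero, mul_comm] at h1
    refine h1.trans (mul_le_mul_of_nonneg_right ?_ (norm_nonneg _))
    -- This makes the Grönwall factor at most 1 + 2 · (1 / 2) = 2.
    have hKt : ((‖N‖₊ + η : ℝ≥0) : ℝ) * t ≤ 1 / 2 := by
      push_cast
      have := ht.2
      have := mul_le_mul_of_nonneg_left this (by positivity : 0 ≤ ‖N‖ + (η : ℝ))
      linarith
    have := exp_le_one_add_two_mul (mul_nonneg (NNReal.coe_nonneg _) ht.1) hKt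
    linarith
  choose! F hF using hsol
  refine ⟨F, hF, fun z hz z' hz' t ht => ?_, fun z hz hXz t ht => ?_⟩
  · have := hdist (F z) (F z') (hF z hz).2 (hF z' hz').2 t ht
    rwa [(hF z hz).1, (hF z' hz').1] at this
  · have := hdist (F z) (fun _ => z) (hF z hz).2 (fun t _ =>
      ⟨closedBall_subset_closedBall (by linarith) hz, by
        simpa [hXz] using hasDerivWithinAt_const t (Icc 0 τ) z⟩) t ht
    rw [(hF z hz).1, sub_self, norm_zero, mul_zero] at this
    exact sub_eq_zero.1 (norm_le_zero_iff.1 this)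

/-- Two nearby solutions that differ initially by `w` with `N (N w) = 0` differ by `w + τ N w`
up to a small error. -/
theorem norm_sub_linear_le {X : V → V} {N : V →L[ℝ] V} {s : Set V} {τ : ℝ} {η : ℝ≥0}
    (happ : ApproximatesLinearOn X N s η) (hη : 0 < η) (hτ : 0 < τ) (hτη : τ * (‖N‖ + η) ≤ 1 / 2)
    {f g : ℝ → V}
    (hf : ∀ t ∈ Icc 0 τ, f t ∈ s ∧ HasDerivWithinAt f (X (f t)) (Icc 0 τ) t)
    (hg : ∀ t ∈ Icc 0 τ, g t ∈ s ∧ HasDerivWithinAt g (X (g t)) (Icc 0 τ) t)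
    (hfg : ∀ t ∈ Icc 0 τ, ‖f t - g t‖ ≤ 2 * ‖f 0 - g 0‖) (hN : N (N (f 0 - g 0)) = 0) :
    ‖f τ - g τ - (f 0 - g 0) - τ • N (f 0 - g 0)‖ ≤ 4 * η * τ * ‖f 0 - g 0‖ := by
  set w := f 0 - g 0 with hw
  let u : ℝ → V := fun t => f t - g t - w - t • N w
  have hu : ∀ t ∈ Icc 0 τ, HasDerivWithinAt u (X (f t) - X (g t) - N w) (Icc 0 τ) t := by
    intro t ht
    have h1 := (((hf t ht).2.fun_sub (hg t ht).2).sub_const w).fun_sub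
      ((hasDerivWithinAt_id t (Icc 0 τ)).smul_const (N w))
    simpa using h1
  -- The rate ‖N‖ + η, rather than ‖N‖, is positive even for N = 0, so the explicit Grönwall bound
  -- applies.
  have hK : 0 < ‖N‖ + η := by positivity
  have h1 := norm_le_gronwallBound_of_norm_deriv_right_le (f := u)
    (f' := fun t => X (f t) - X (g t) - N w) (δ := 0) (K := ‖N‖ + η) (ε := η * (2 * ‖w‖))
    (a := 0) (b := τ) (fun t ht => (hu t ht).continuousWithinAt)
    (fun t ht => hasDerivWithinAt_Ici_of_Icc ht (hu t (Ico_subset_Icc_self ht)))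
    (by simp [u, hw]) (fun t ht => by
      have ht' := Ico_subset_Icc_self ht
      -- Since N (N w) = 0, N (f t - g t) = N (u t) + N w: the comparison curve w + t N w solves the
      -- linearized equation.
      have e1 : X (f t) - X (g t) - N w = (X (f t) - X (g t) - N (f t - g t)) + N (u t) := by
        simp only [u, map_sub, map_smul]
        rw [show N (N w) = 0 from hN]
        simp
      rw [e1]
      refine (norm_add_le _ _).trans ?_
      have h2 := happ (f t) (hf t ht').1 (g t) (hg t ht').1
      have h3 := N.le_opNorm (u t)
      have h4 := mul_le_mul_of_nonneg_left (hfg t ht') η.coe_nonneg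
      have h5 : 0 ≤ (η : ℝ) * ‖u t‖ := by positivity
      linarith) τ (right_mem_Icc.2 hτ.le)
  simp only [gronwallBound_of_K_ne_0 hK.ne', zero_mul, zero_add, sub_zero] at h1
  refine h1.trans ?_
  have h2 := exp_le_one_add_two_mul (x := (‖N‖ + η) * τ) (by positivity) (by linarith)
  calc η * (2 * ‖w‖) / (‖N‖ + η) * (Real.exp ((‖N‖ + η) * τ) - 1)
      ≤ η * (2 * ‖w‖) / (‖N‖ + η) * (2 * ((‖N‖ + η) * τ)) := by
        gcongr
        linarith
    _ = 4 * η * τ * ‖w‖ := by field_simp; ring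

/-- Backward Grönwall estimate for a scalar linear equation. -/
theorem abs_le_exp_mul_abs_of_hasDerivWithinAt {f l : ℝ → ℝ} {τ C : ℝ} (hτ : 0 ≤ τ)
    (hf : ∀ t ∈ Icc 0 τ, HasDerivWithinAt f (l t * f t) (Icc 0 τ) t)
    (hl : ∀ t ∈ Icc 0 τ, |l t| ≤ C) : |f 0| ≤ Real.exp (C * τ) * |f τ| := by
  have hmaps : MapsTo (fun t => τ - t) (Icc 0 τ) (Icc 0 τ) := fun t ht =>
    ⟨by linarith [ht.2], by linarith [ht.1]⟩
  have hg : ∀ t ∈ Icc 0 τ, HasDerivWithinAt (fun t => f (τ - t)) (-(l (τ - t) * f (τ - t)))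
      (Icc 0 τ) t := by
    intro t ht
    have h1 : HasDerivWithinAt (fun t => τ - t) (-1) (Icc 0 τ) t := by
      simpa using (hasDerivWithinAt_id t (Icc 0 τ)).const_sub τ
    have h2 := (hf _ (hmaps ht)).scomp t h1 hmaps
    simpa [Function.comp_def] using h2
  have h1 := norm_le_gronwallBound_of_norm_deriv_right_le (f := fun t => f (τ - t))
    (f' := fun t => -(l (τ - t) * f (τ - t))) (δ := |f τ|) (K := C) (ε := 0) (a := 0) (b := τ)
    (fun t ht => (hg t ht).continuousWithinAt)
    (fun t ht => hasDerivWithinAt_Ici_of_Icc ht (hg t (Ico_subset_Icc_self ht)))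
    (by simp) (fun t ht => by
      rw [norm_neg, norm_mul, add_zero]
      exact mul_le_mul_of_nonneg_right (hl _ (hmaps (Ico_subset_Icc_self ht))) (norm_nonneg _))
    τ (right_mem_Icc.2 hτ)
  rw [gronwallBound_ε0] at h1
  simpa [mul_comm] using h1

end Flow

/-! ### Polynomials that are small to an order above their degree -/

section Polynomials

/-- The constant term is the limit at 0, hence zero; divide by s and induct. The punctured
neighbourhood is what allows the division. -/
theorem polynomial_eq_zero_of_isBigO (d : ℕ) : ∀ {Q : Polynomial ℝ}, Q.natDegree ≤ d →
    (fun s => Q.eval s) =O[𝓝[≠] 0] (fun s : ℝ => s ^ (d + 1)) → Q = 0 := by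
  have hcoeff : ∀ (d : ℕ) {Q : Polynomial ℝ},
      (fun s => Q.eval s) =O[𝓝[≠] 0] (fun s : ℝ => s ^ (d + 1)) → Q.coeff 0 = 0 := by
    intro d Q h
    have h1 : Filter.Tendsto (fun s : ℝ => s ^ (d + 1)) (𝓝[≠] 0) (𝓝 0) := by
      have : Filter.Tendsto (fun s : ℝ => s ^ (d + 1)) (𝓝 0) (𝓝 (0 ^ (d + 1))) :=
        (continuous_pow (d + 1)).tendsto 0
      rw [zero_pow (by omega)] at this
      exact this.mono_left nhdsWithin_le_nhds
    have h2 := h.trans_tendsto h1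
    have h3 : Filter.Tendsto (fun s => Q.eval s) (𝓝[≠] 0) (𝓝 (Q.eval 0)) :=
      (Q.continuous.tendsto 0).mono_left nhdsWithin_le_nhds
    rw [Polynomial.coeff_zero_eq_eval_zero]
    exact tendsto_nhds_unique h3 h2
  induction d with
  | zero =>
    intro Q hQ h
    rw [Polynomial.eq_C_of_natDegree_le_zero hQ, hcoeff 0 h, Polynomial.C_0]
  | succ d ih =>
    intro Q hQ h
    have h0 := hcoeff (d + 1) h
    have hdiv : Q = Q.divX * Polynomial.X := by
      conv_lhs => rw [← Q.divX_mul_X_add, h0, Polynomial.C_0, add_zero]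
    have h1 : Q.divX = 0 := by
      refine ih (by rw [Polynomial.natDegree_divX_eq_natDegree_tsub_one]; omega) ?_
      have h2 := h.mul (Asymptotics.isBigO_refl (fun s : ℝ => s⁻¹) (𝓝[≠] 0))
      refine h2.congr' ?_ ?_
      · filter_upwards [self_mem_nhdsWithin] with s hs
        rw [hdiv]
        simp only [Polynomial.eval_mul, Polynomial.eval_X, mul_assoc, mul_inv_cancel₀ hs, mul_one]
        rw [← hdiv]
      · filter_upwards [self_mem_nhdsWithin] with s hs
        rw [pow_succ, mul_assoc, mul_inv_cancel₀ hs, mul_one]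
    rw [hdiv, h1, zero_mul]

/-- Restrict P to the line from p₀ through p and use the one-variable case. -/
theorem eval_eq_zero_of_isBigO {P : MvPolynomial (Fin m) ℝ} (hP : P.IsHomogeneous d)
    {p₀ : Coord m}
    (h : (fun p : Coord m => eval p.ofLp P) =O[𝓝 p₀] fun p => ‖p - p₀‖ ^ (d + 1))
    (p : Coord m) : eval p.ofLp P = 0 := by
  let line : Fin m → Polynomial ℝ := fun i =>
    Polynomial.C ((p - p₀).ofLp i) * Polynomial.X + Polynomial.C (p₀.ofLp i)
  obtain ⟨Q, hQdef⟩ : ∃ Q : Polynomial ℝ, Q = aeval line P := ⟨_, rfl⟩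
  have hQ : ∀ s : ℝ, Q.eval s = eval (p₀ + s • (p - p₀)).ofLp P := by
    intro s
    have hcomp : (Polynomial.aeval s).comp (aeval line) = aeval (R := ℝ) (p₀ + s • (p - p₀)).ofLp := by
      rw [comp_aeval]
      refine congrArg aeval (funext fun i => ?_)
      simp [line]
      ring
    have := DFunLike.congr_fun hcomp P
    rw [hQdef, ← Polynomial.coe_aeval_eq_eval, ← aeval_eq_eval]
    exact this
  have hdeg : Q.natDegree ≤ d := by
    rw [hQdef, ← mul_one d]
    exact MvPolynomial.aeval_natDegree_le P hP.totalDegree_le line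
      fun i => Polynomial.natDegree_linear_le
  have hline : Filter.Tendsto (fun s : ℝ => p₀ + s • (p - p₀)) (𝓝[≠] 0) (𝓝 p₀) := by
    have : Continuous fun s : ℝ => p₀ + s • (p - p₀) := by fun_prop
    have := this.tendsto 0
    simp only [zero_smul, add_zero] at this
    exact this.mono_left nhdsWithin_le_nhds
  have hO : (fun s => Q.eval s) =O[𝓝[≠] 0] (fun s : ℝ => s ^ (d + 1)) := by
    have h1 := h.comp_tendsto hline
    simp only [Function.comp_def, ← hQ] at h1
    refine h1.trans (Asymptotics.IsBigO.of_bound (‖p - p₀‖ ^ (d + 1)) (.of_forall fun s => ?_))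
    simp [norm_smul, mul_pow, mul_comm]
  have := hQ 1
  rw [polynomial_eq_zero_of_isBigO d hdeg hO] at this
  simpa using this.symm

end Polynomials

end RelativeKilling
end

/-! ### Local unique continuation by shooting geodesics -/

noncomputable section

namespace RelativeKilling

open MvPolynomial Set Topology Metric
open scoped NNReal

variable {m d n : ℕ} {U : Set (Coord m)} {A : Coord m → Coord m →L[ℝ] Coord m}
  {b : Coord m → Coord m → Coord m} {l k : Coord m → Coord m → ℝ} {x y : Coord m}

theorem fderiv_prod_apply {k : Coord m → Coord m → ℝ} {q p u v : Coord m}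
    (h : DifferentiableAt ℝ (fun z : Coord m × Coord m => k z.1 z.2) (q, p)) :
    fderiv ℝ (fun z : Coord m × Coord m => k z.1 z.2) (q, p) (u, v)
      = fderiv ℝ (fun q' => k q' p) q u + fderiv ℝ (k q) p v := by
  have h1 : HasFDerivAt (fun q' => k q' p) _ q :=
    HasFDerivAt.comp (f := fun q' : Coord m => (q', p)) q h.hasFDerivAt (hasFDerivAt_prodMk_left q p)
  have h2 : HasFDerivAt (k q) _ p :=
    HasFDerivAt.comp (f := fun p' : Coord m => (q, p')) p h.hasFDerivAt (hasFDerivAt_prodMk_right q p)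
  rw [h1.fderiv, h2.fderiv]
  simp [← map_add]

/-- The vector field `(A(q) p, b(q, p))` on phase space. -/
def phaseField (A : Coord m → Coord m →L[ℝ] Coord m) (b : Coord m → Coord m → Coord m)
    (z : Coord m × Coord m) : Coord m × Coord m :=
  (A z.1 z.2, b z.1 z.2)

theorem GeodesicField.snd_zero (hG : GeodesicField U A b) {q : Coord m} (hq : q ∈ U) :
    b q 0 = 0 := by
  simpa using hG.quadratic q hq 0 0

/-- The linear part of the geodesic field at a zero momentum. -/
theorem GeodesicField.hasStrictFDerivAt (hG : GeodesicField U A b) (hy : y ∈ U) :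
    HasStrictFDerivAt (phaseField A b)
      (((A y).comp (ContinuousLinearMap.snd ℝ (Coord m) (Coord m))).prod 0) (y, 0) := by
  have hmem : U ×ˢ (univ : Set (Coord m)) ∈ 𝓝 (y, (0 : Coord m)) :=
    (hG.isOpen.prod isOpen_univ).mem_nhds ⟨hy, mem_univ _⟩
  have hA : ContDiffAt ℝ ∞ (fun z : Coord m × Coord m => A z.1) (y, 0) :=
    (hG.smooth_fst.contDiffAt (hG.isOpen.mem_nhds hy)).comp (y, (0 : Coord m)) contDiffAt_fst
  have hb : ContDiffAt ℝ ∞ (fun z : Coord m × Coord m => b z.1 z.2) (y, 0) :=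
    hG.smooth_snd.contDiffAt hmem
  have h1 : HasStrictFDerivAt (fun z : Coord m × Coord m => A z.1 z.2)
      ((A y).comp (ContinuousLinearMap.snd ℝ (Coord m) (Coord m))) (y, 0) := by
    have hsnd : HasStrictFDerivAt (Prod.snd : Coord m × Coord m → Coord m)
        (ContinuousLinearMap.snd ℝ (Coord m) (Coord m)) (y, 0) := hasStrictFDerivAt_snd
    have hA' : HasStrictFDerivAt (fun z : Coord m × Coord m => A z.1)
        (fderiv ℝ (fun z : Coord m × Coord m => A z.1) (y, 0)) (y, 0) :=
      hA.hasStrictFDerivAt (by simp)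
    refine (hA'.clm_apply hsnd).congr_fderiv ?_
    exact ContinuousLinearMap.ext fun v => by simp
  have h2 : HasStrictFDerivAt (fun z : Coord m × Coord m => b z.1 z.2)
      (0 : Coord m × Coord m →L[ℝ] Coord m) (y, 0) := by
    have hs := hb.hasStrictFDerivAt (by simp)
    refine hs.congr_fderiv ?_
    have hcurve : ∀ w : Coord m × Coord m, HasDerivAt (fun t : ℝ => b (y + t • w.1) (t • w.2))
        (fderiv ℝ (fun z : Coord m × Coord m => b z.1 z.2) (y, 0) w) 0 := by
      intro w
      have hc : HasDerivAt (fun t : ℝ => (y + t • w.1, t • w.2)) w 0 := by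
        have e1 := ((hasDerivAt_id (0 : ℝ)).smul_const w.1).const_add y
        have e2 := (hasDerivAt_id (0 : ℝ)).smul_const w.2
        simpa using e1.prodMk e2
      have hs' : HasFDerivAt (fun z : Coord m × Coord m => b z.1 z.2)
          (fderiv ℝ (fun z : Coord m × Coord m => b z.1 z.2) (y, 0))
          (y + (0 : ℝ) • w.1, (0 : ℝ) • w.2) := by
        simpa using hs.hasFDerivAt
      exact hs'.comp_hasDerivAt (0 : ℝ) hc
    -- The derivative of b is zero at (y, 0): b vanishes at zero momentum, which settles the
    -- position directions, and is quadratic in p, which settles the momentum directions.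
    have hleft : ∀ u : Coord m,
        fderiv ℝ (fun z : Coord m × Coord m => b z.1 z.2) (y, 0) (u, 0) = 0 := by
      intro u
      refine (hcurve (u, 0)).unique ?_
      have hev : ∀ᶠ t in 𝓝 (0 : ℝ), y + t • u ∈ U := by
        have : Filter.Tendsto (fun t : ℝ => y + t • u) (𝓝 0) (𝓝 (y + (0 : ℝ) • u)) :=
          (by fun_prop : Continuous fun t : ℝ => y + t • u).tendsto 0
        rw [zero_smul, add_zero] at this
        exact this (hG.isOpen.mem_nhds hy)
      refine (hasDerivAt_const (0 : ℝ) (0 : Coord m)).congr_of_eventuallyEq ?_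
      filter_upwards [hev] with t ht
      simpa using hG.snd_zero ht
    have hright : ∀ v : Coord m,
        fderiv ℝ (fun z : Coord m × Coord m => b z.1 z.2) (y, 0) (0, v) = 0 := by
      intro v
      refine (hcurve (0, v)).unique ?_
      have := ((hasDerivAt_id (0 : ℝ)).pow 2).smul_const (b y v)
      simp only [id, smul_zero, add_zero] at this ⊢
      convert! this using 1
      · ext1 t
        simp [hG.quadratic y hy]
      · simp
    refine ContinuousLinearMap.ext fun w => ?_
    have : w = (w.1, 0) + (0, w.2) := by simp
    rw [this, map_add, hleft, hright]
    simp
  exact h1.prodMk h2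

/-- Near `x₀`, a form vanishing to order `n` at `x₀` is of order `n`, locally uniformly in the
momenta. -/
theorem SmoothForm.isBigO_of_vanishes (hU : IsOpen U) (hk : SmoothForm d U k) (hx : x ∈ U)
    (hv : ∀ p, VanishesToOrder n (fun q => k q p) x) {f : Coord m → Coord m × Coord m}
    {F : Filter (Coord m)} (hf : Filter.Tendsto (fun p => (f p).1) F (𝓝 x)) {R : ℝ}
    (hR : ∀ᶠ p in F, ‖(f p).2‖ ≤ R) :
    (fun p => k (f p).1 (f p).2) =O[F] fun p => ‖(f p).1 - x‖ ^ n := by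
  obtain ⟨s, P, hP, hint⟩ := exists_homogeneous_interpolation m d
  have h1 : (fun p => k (f p).1 (f p).2)
      =ᶠ[F] fun p => ∑ y : s, k (f p).1 y * eval (f p).2.ofLp (P y) := by
    filter_upwards [hf (hU.mem_nhds hx)] with p hp
    obtain ⟨Q, hQ, hkQ⟩ := hk.homogeneous (f p).1 hp
    simp only [hkQ]
    exact hint Q hQ _
  refine h1.trans_isBigO (Asymptotics.IsBigO.fun_sum fun y _ => ?_)
  have h2 := (VanishesToOrder.isBigO n ((contDiffOn_left hk.smooth y.1).contDiffAt (hU.mem_nhds hx))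
    (hv y)).comp_tendsto hf
  have h3 : (fun p => eval (f p).2.ofLp (P y)) =O[F] fun _ => (1 : ℝ) := by
    obtain ⟨C, hC⟩ := (isCompact_closedBall (0 : Coord m) R).exists_bound_of_continuousOn
      (contDiff_eval (P y)).continuous.continuousOn
    refine Asymptotics.IsBigO.of_bound C ?_
    filter_upwards [hR] with p hp
    simpa using hC (f p).2 (by simpa using hp)
  simpa [Function.comp_def] using h2.mul h3

/-- Near every point there is a ball in which a transported form of degree `d` that vanishes to
order `d + 1` at one point vanishes identically. -/
theorem exists_ball_forall_eq_zero (hG : GeodesicField U A b) (hk : SmoothForm d U k)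
    (hl : ContDiffOn ℝ ∞ (fun z : Coord m × Coord m => l z.1 z.2) (U ×ˢ univ))
    (ht : IsTransported U A b l k) (hy : y ∈ U) :
    ∃ r > 0, ball y r ⊆ U ∧ ∀ x₀ ∈ ball y r,
      (∀ p, VanishesToOrder (d + 1) (fun q => k q p) x₀) → ∀ x ∈ ball y r, ∀ p, k x p = 0 := by
  have hopen := hG.isOpen.prod (isOpen_univ (X := Coord m))
  have hmem : U ×ˢ (univ : Set (Coord m)) ∈ 𝓝 (y, (0 : Coord m)) :=
    hopen.mem_nhds ⟨hy, mem_univ _⟩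
  obtain ⟨N, hN⟩ : ∃ N, N = ((A y).comp (ContinuousLinearMap.snd ℝ (Coord m) (Coord m))).prod
    (0 : Coord m × Coord m →L[ℝ] Coord m) := ⟨_, rfl⟩
  obtain ⟨B, hB⟩ : ∃ B : Coord m →L[ℝ] Coord m, ∀ v, A y (B v) = v := by
    obtain ⟨B, hB⟩ := LinearMap.exists_rightInverse_of_surjective (A y : Coord m →ₗ[ℝ] Coord m)
      (LinearMap.range_eq_top.2 (hG.bijective y hy).2)
    exact ⟨LinearMap.toContinuousLinearMap B, fun v => LinearMap.congr_fun hB v⟩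
  -- Order of the choices: τ depends on N only, ν bounds the right inverse τ⁻¹ B of τ A(y), then η
  -- is small relative to both, and only then the radius a is obtained. The flow time must not
  -- shrink with a.
  set τ : ℝ := 1 / (2 * (‖N‖ + 1)) with hτdef
  have hτ : 0 < τ := by positivity
  set ν : ℝ := τ⁻¹ * ‖B‖ + 1 with hν
  have hν0 : 0 < ν := by positivity
  obtain ⟨η, hη, hη1, hην⟩ : ∃ η : ℝ≥0, 0 < η ∧ (η : ℝ) ≤ 1 ∧ 4 * (η : ℝ) * τ ≤ ν⁻¹ / 2 := by
    have hpos : 0 < min 1 (ν⁻¹ / (8 * τ)) := by positivity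
    refine ⟨(min 1 (ν⁻¹ / (8 * τ))).toNNReal, Real.toNNReal_pos.2 hpos, ?_, ?_⟩
    · rw [Real.coe_toNNReal _ hpos.le]
      exact min_le_left _ _
    · rw [Real.coe_toNNReal _ hpos.le]
      calc 4 * min 1 (ν⁻¹ / (8 * τ)) * τ ≤ 4 * (ν⁻¹ / (8 * τ)) * τ := by
            gcongr; exact min_le_right _ _
        _ = ν⁻¹ / 2 := by field_simp; norm_num
  have hτη : τ * (‖N‖ + η) ≤ 1 / 2 := by
    calc τ * (‖N‖ + η) ≤ τ * (‖N‖ + 1) := by gcongr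
      _ = 1 / 2 := by rw [hτdef]; field_simp
  have hlcont : ContinuousAt (fun z : Coord m × Coord m => l z.1 z.2) (y, 0) :=
    (hl.continuousOn).continuousAt hmem
  obtain ⟨C, hC⟩ : ∃ C, C = |l y 0| + 1 := ⟨_, rfl⟩
  have hW : {z : Coord m × Coord m | |l z.1 z.2| ≤ C} ∩ U ×ˢ univ ∈ 𝓝 (y, (0 : Coord m)) := by
    refine Filter.inter_mem ?_ hmem
    have := hlcont.abs.eventually (Iio_mem_nhds (show |l y 0| < C by rw [hC]; linarith))
    exact this.mono fun z hz => le_of_lt hz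
  have hX0 : phaseField A b (y, 0) = 0 := by simp [phaseField, hG.snd_zero hy]
  obtain ⟨a, ha, haW, happ, F, hF, hF2, hFeq⟩ := exists_flow_near_equilibrium
    (hN ▸ hG.hasStrictFDerivAt hy) hX0 hη hτ hτη hW
  have hpair : ∀ {q p : Coord m} {c : ℝ}, q ∈ closedBall y c → p ∈ closedBall 0 c →
      (q, p) ∈ closedBall (y, (0 : Coord m)) c := fun hq hp => by
    rw [← closedBall_prod_same]; exact ⟨hq, hp⟩
  -- N (u, v) = (A(y) v, 0) has square zero, so two solutions from the same q differ at time τ, in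
  -- position, by τ A(y) (p - p') up to the error 4 η τ ‖p - p'‖.
  have hshoot : ∀ q ∈ closedBall y (a / 2), ApproximatesLinearOn (fun p => (F (q, p) τ).1)
      (τ • A y) (closedBall 0 (a / 2)) (4 * η * τ.toNNReal) := by
    intro q hq p hp p' hp'
    have hz := hpair hq hp
    have hz' := hpair hq hp'
    have hdiff : F (q, p) 0 - F (q, p') 0 = (0, p - p') := by
      rw [(hF _ hz).1, (hF _ hz').1]; simp
    have h1 := norm_sub_linear_le happ hη hτ hτη (hF _ hz).2 (hF _ hz').2
      (fun t ht => by
        rw [(hF _ hz).1, (hF _ hz').1]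
        exact hF2 _ hz _ hz' t ht)
      (by rw [hdiff, hN]; simp)
    rw [hdiff] at h1
    have h2 := (norm_fst_le _).trans h1
    push_cast
    rw [Real.coe_toNNReal _ hτ.le]
    simpa [hN, Prod.norm_def] using h2
  have hone : ∀ q ∈ closedBall y (a / 2), closedBall y (a / 2) ⊆ U := fun q hq q' hq' =>
    (haW (closedBall_subset_closedBall (by linarith) (hpair hq'
      (mem_closedBall_self (by linarith))))).2.1
  have hbase : ∀ q ∈ closedBall y (a / 2), F (q, 0) τ = (q, 0) := by
    intro q hq
    have hz := hpair hq (mem_closedBall_self (x := (0 : Coord m)) (by linarith : 0 ≤ a / 2))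
    refine hFeq _ hz ?_ τ (right_mem_Icc.2 hτ.le)
    simp [phaseField, hG.snd_zero (hone q hq hq)]
  let inv : (τ • A y).NonlinearRightInverse :=
    { toFun := fun v => τ⁻¹ • B v
      nnnorm := ν.toNNReal
      bound' := fun v => by
        rw [norm_smul, Real.norm_eq_abs, abs_of_pos (inv_pos.2 hτ)]
        rw [Real.coe_toNNReal _ hν0.le]
        have := B.le_opNorm v
        have h2 : τ⁻¹ * ‖B v‖ ≤ τ⁻¹ * (‖B‖ * ‖v‖) := by gcongr
        have := norm_nonneg v
        rw [hν]
        linarith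
      right_inv' := fun v => by simp [hB, hτ.ne'] }
  -- Shooting with ‖p‖ ≤ a / 4 covers the ball about q of radius (ν⁻¹ - 4 η τ) (a / 4) ≥ ν⁻¹ / 2 *
  -- (a / 4). The last halving is because x₀ and q are both at distance less than r from y. Taking a
  -- / 4 instead of a / 2 leaves p₀ in the interior of the momenta for which the flow exists.
  refine ⟨min (a / 2) (ν⁻¹ / 2 * (a / 4) / 2), by positivity, ?_, ?_⟩
  · exact (ball_subset_closedBall.trans (closedBall_subset_closedBall (min_le_left _ _))).trans
      (hone y (mem_closedBall_self (by linarith)))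
  intro x₀ hx₀ hv q hq
  have hqb : q ∈ closedBall y (a / 2) :=
    closedBall_subset_closedBall (min_le_left _ _) (ball_subset_closedBall hq)
  have hx₀b : x₀ ∈ closedBall y (a / 2) :=
    closedBall_subset_closedBall (min_le_left _ _) (ball_subset_closedBall hx₀)
  have hx₀U : x₀ ∈ U := hone y (mem_closedBall_self (by linarith)) hx₀b
  have hsub : closedBall (0 : Coord m) (a / 4) ⊆ closedBall 0 (a / 2) :=
    closedBall_subset_closedBall (by linarith)
  obtain ⟨p₀, hp₀, hp₀x⟩ : ∃ p₀ ∈ closedBall (0 : Coord m) (a / 4), (F (q, p₀) τ).1 = x₀ := by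
    refine (hshoot q hqb).surjOn_closedBall_of_nonlinearRightInverse inv (by linarith) hsub ?_
    rw [hbase q hqb]
    have h1 : dist x₀ q < ν⁻¹ / 2 * (a / 4) := by
      have e1 : dist x₀ y < ν⁻¹ / 2 * (a / 4) / 2 := lt_of_lt_of_le hx₀ (min_le_right _ _)
      have e2 : dist q y < ν⁻¹ / 2 * (a / 4) / 2 := lt_of_lt_of_le hq (min_le_right _ _)
      have := dist_triangle_right x₀ q y
      linarith
    refine h1.le.trans ?_
    gcongr
    change ν⁻¹ / 2 ≤ (ν.toNNReal : ℝ)⁻¹ - (4 * η * τ.toNNReal : ℝ≥0)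
    push_cast
    rw [Real.coe_toNNReal _ hν0.le, Real.coe_toNNReal _ hτ.le]
    linarith
  have hnear : ∀ᶠ p in 𝓝 p₀, p ∈ closedBall (0 : Coord m) (a / 2) := by
    have : p₀ ∈ ball (0 : Coord m) (a / 2) := closedBall_subset_ball (by linarith) hp₀
    filter_upwards [isOpen_ball.mem_nhds this] with p hp using ball_subset_closedBall hp
  have hend : ∀ᶠ p in 𝓝 p₀, ‖(F (q, p) τ).1 - x₀‖ ≤ 2 * ‖p - p₀‖ := by
    filter_upwards [hnear] with p hp
    have := hF2 _ (hpair hqb hp) _ (hpair hqb (hsub hp₀)) τ (right_mem_Icc.2 hτ.le)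
    rw [← hp₀x]
    simpa [Prod.norm_def] using (norm_fst_le _).trans this
  have htend : Filter.Tendsto (fun p => (F (q, p) τ).1) (𝓝 p₀) (𝓝 x₀) := by
    rw [tendsto_iff_norm_sub_tendsto_zero]
    refine squeeze_zero' (.of_forall fun _ => norm_nonneg _) hend ?_
    have : Continuous fun p : Coord m => 2 * ‖p - p₀‖ := by fun_prop
    simpa using this.tendsto p₀
  have hbound : ∀ᶠ p in 𝓝 p₀, ‖(F (q, p) τ).2‖ ≤ a := by
    filter_upwards [hnear] with p hp
    have h1 := ((hF _ (hpair hqb hp)).2 τ (right_mem_Icc.2 hτ.le)).1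
    rw [← closedBall_prod_same] at h1
    simpa using h1.2
  -- Along a solution, k satisfies f' = l f, and |l| ≤ C because the solution stays in the
  -- neighbourhood chosen above.
  have hgrow : ∀ᶠ p in 𝓝 p₀, ‖k q p‖ ≤ Real.exp (C * τ) *
      ‖k (F (q, p) τ).1 (F (q, p) τ).2‖ := by
    filter_upwards [hnear] with p hp
    have hz := hpair hqb hp
    have h1 := abs_le_exp_mul_abs_of_hasDerivWithinAt (C := C)
      (f := fun t => k (F (q, p) t).1 (F (q, p) t).2)
      (l := fun t => l (F (q, p) t).1 (F (q, p) t).2) hτ.le (fun t htt => by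
        obtain ⟨hm, hd⟩ := (hF _ hz).2 t htt
        have hmU := (haW hm).2
        have hdiff : DifferentiableAt ℝ (fun z : Coord m × Coord m => k z.1 z.2)
            ((F (q, p) t).1, (F (q, p) t).2) :=
          (hk.smooth.contDiffAt (hopen.mem_nhds hmU)).differentiableAt (by simp)
        have h2 := HasFDerivAt.comp_hasDerivWithinAt (x := t) (f := F (q, p))
          (l := fun z : Coord m × Coord m => k z.1 z.2) hdiff.hasFDerivAt hd
        rw [phaseField, fderiv_prod_apply hdiff, ht _ hmU.1] at h2
        exact h2)
      (fun t htt => (haW ((hF _ hz).2 t htt).1).1)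
    simpa [(hF _ hz).1] using h1
  have hO : (fun p => k q p) =O[𝓝 p₀] fun p => ‖p - p₀‖ ^ (d + 1) := by
    refine (Asymptotics.IsBigO.of_bound _ hgrow).trans ?_
    refine (hk.isBigO_of_vanishes hG.isOpen hx₀U hv (f := fun p => F (q, p) τ) htend hbound).trans ?_
    refine Asymptotics.IsBigO.of_bound (2 ^ (d + 1)) ?_
    filter_upwards [hend] with p hp
    rw [norm_pow, norm_pow, norm_norm, norm_norm, ← mul_pow]
    gcongr
  obtain ⟨P, hP, hkP⟩ := hk.homogeneous q (hone y (mem_closedBall_self (by linarith)) hqb)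
  intro p
  rw [hkP]
  refine eval_eq_zero_of_isBigO hP (p₀ := p₀) ?_ p
  simpa only [hkP] using hO

end RelativeKilling
end

/-! ### The metric and its Hamiltonian field in coordinates -/

noncomputable section

namespace RelativeKilling

open MvPolynomial Set Topology Metric

variable {m d : ℕ} {M : Type*} [TopologicalSpace M] [ChartedSpace (EuclideanSpace ℝ (Fin m)) M]
  {e : OpenPartialHomeomorph M (EuclideanSpace ℝ (Fin m))} {q : Coord m}

theorem IsSymTensor.smoothForm {K : CotangentFun m M} (hK : IsSymTensor d K)
    (he : e ∈ atlas (EuclideanSpace ℝ (Fin m)) M) : SmoothForm d e.target (inCoords e K) where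
  smooth := hK.smooth e he
  homogeneous q hq := by
    obtain ⟨T, hT⟩ := hK.homogeneous (e.symm q)
    obtain ⟨P, hP, hev⟩ := exists_homogeneous_eval T (coordCovec e q)
    exact ⟨P, hP, fun p => (hT _).trans (hev _)⟩

section Coordinates

variable [IsManifold (𝓡 m) ∞ M]

theorem mdifferentiable_chart_of_mem_atlas (he : e ∈ atlas (EuclideanSpace ℝ (Fin m)) M) :
    e.MDifferentiable (𝓡 m) (𝓡 m) := by
  have : IsManifold (𝓡 m) 1 M := IsManifold.of_le (n := ∞) (by norm_cast)
  exact mdifferentiable_of_mem_atlas he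

theorem coordCovec_coordVec (he : e ∈ atlas (EuclideanSpace ℝ (Fin m)) M) (hq : q ∈ e.target)
    (i j : Fin m) : coordCovec e q i (coordVec e q j) = if i = j then 1 else 0 := by
  have h := congrArg (fun T => T (stdVec j))
    ((mdifferentiable_chart_of_mem_atlas he).comp_symm_deriv hq)
  have h2 : mfderiv (𝓡 m) (𝓡 m) e (e.symm q) (coordVec e q j) = stdVec j := h
  change (EuclideanSpace.proj i : EuclideanSpace ℝ (Fin m) →L[ℝ] ℝ)
    (mfderiv (𝓡 m) (𝓡 m) e (e.symm q) (coordVec e q j)) = _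
  rw [h2]
  simp [stdVec]

theorem sum_coordCovec_smul_coordVec (he : e ∈ atlas (EuclideanSpace ℝ (Fin m)) M)
    (hq : q ∈ e.target) (w : TangentSpace (𝓡 m) (e.symm q)) :
    ∑ i, coordCovec e q i w • coordVec e q i = w := by
  have hd := mdifferentiable_chart_of_mem_atlas he
  refine (hd.mfderiv_bijective (e.map_target hq)).1 ?_
  have h2 : ∀ j, mfderiv (𝓡 m) (𝓡 m) e (e.symm q) (coordVec e q j) = stdVec j := fun j =>
    congrArg (fun T => T (stdVec j)) (hd.comp_symm_deriv hq)
  rw [map_sum]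
  simp only [map_smul, h2]
  change ∑ i, (mfderiv (𝓡 m) (𝓡 m) e (e.symm q) w : Coord m).ofLp i • (stdVec i : Coord m)
    = (mfderiv (𝓡 m) (𝓡 m) e (e.symm q) w : Coord m)
  ext j
  simp [stdVec, Pi.single_apply]

theorem eq_sum_smul_coordCovec (he : e ∈ atlas (EuclideanSpace ℝ (Fin m)) M)
    (hq : q ∈ e.target) (c : Cotangent m (e.symm q)) :
    c = ∑ i, c (coordVec e q i) • coordCovec e q i := by
  refine ContinuousLinearMap.ext fun w => ?_
  conv_lhs => rw [← sum_coordCovec_smul_coordVec he hq w]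
  simp [mul_comm]

end Coordinates

/-- The operator on coordinate vectors given by the Gram matrix `g_ij(q)`. -/
def gramOp (g : PseudoRiemannianMetric m M)
    (e : OpenPartialHomeomorph M (EuclideanSpace ℝ (Fin m))) (q : Coord m) :
    Coord m →L[ℝ] Coord m :=
  ∑ i, ∑ j, g.val (e.symm q) (coordVec e q i) (coordVec e q j) •
    (EuclideanSpace.proj j : Coord m →L[ℝ] ℝ).smulRight (stdVec i)

theorem gramOp_apply (g : PseudoRiemannianMetric m M) (v : Coord m) (i : Fin m) :
    (gramOp g e q v).ofLp i
      = ∑ j, g.val (e.symm q) (coordVec e q i) (coordVec e q j) * v.ofLp j := by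
  simp [gramOp, stdVec, Pi.single_apply, Finset.sum_apply]

theorem sum_gramOp_mul (g : PseudoRiemannianMetric m M) (v w : Coord m) :
    ∑ i, (gramOp g e q v).ofLp i * w.ofLp i
      = g.val (e.symm q) (∑ j, v.ofLp j • coordVec e q j) (∑ i, w.ofLp i • coordVec e q i) := by
  simp only [gramOp_apply, map_sum, map_smul, sum_apply, smul_apply, smul_eq_mul, Finset.mul_sum,
    Finset.sum_mul]
  refine Finset.sum_congr rfl fun i _ => Finset.sum_congr rfl fun j _ => ?_
  rw [g.symm]
  ring

theorem sum_gramOp_mul_comm (g : PseudoRiemannianMetric m M) (v w : Coord m) :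
    ∑ i, (gramOp g e q v).ofLp i * w.ofLp i = ∑ i, v.ofLp i * (gramOp g e q w).ofLp i := by
  rw [sum_gramOp_mul, g.symm, ← sum_gramOp_mul]
  simp only [mul_comm]

theorem contDiffOn_gramOp (g : PseudoRiemannianMetric m M)
    (he : e ∈ atlas (EuclideanSpace ℝ (Fin m)) M) : ContDiffOn ℝ ∞ (gramOp g e) e.target := by
  unfold gramOp
  exact ContDiffOn.sum fun i _ => ContDiffOn.sum fun j _ =>
    (g.smooth e he i j).smul contDiffOn_const

variable [IsManifold (𝓡 m) ∞ M]

theorem gramOp_isInvertible (g : PseudoRiemannianMetric m M)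
    (he : e ∈ atlas (EuclideanSpace ℝ (Fin m)) M) (hq : q ∈ e.target) :
    (gramOp g e q).IsInvertible := by
  have hinj : Function.Injective (gramOp g e q : Coord m →ₗ[ℝ] Coord m) := by
    rw [injective_iff_map_eq_zero]
    intro v hv
    have h0 : ∑ j, v.ofLp j • coordVec e q j = 0 := by
      refine g.nondegenerate _ _ fun w => ?_
      rw [← sum_coordCovec_smul_coordVec he hq w]
      have := sum_gramOp_mul (e := e) (q := q) g v (.toLp 2 fun i => coordCovec e q i w)
      rw [← this, show gramOp g e q v = 0 from hv]
      simp
    ext i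
    have h1 := congrArg (coordCovec e q i) h0
    simpa [coordCovec_coordVec he hq] using h1
  exact ⟨(LinearEquiv.ofInjectiveEndo _ hinj).toContinuousLinearEquiv, by ext; rfl⟩

/-- The operator on coordinate vectors given by the inverse metric `gⁱʲ(q)`. -/
def cogramOp (g : PseudoRiemannianMetric m M)
    (e : OpenPartialHomeomorph M (EuclideanSpace ℝ (Fin m))) (q : Coord m) :
    Coord m →L[ℝ] Coord m :=
  (gramOp g e q).inverse

theorem gramOp_cogramOp (g : PseudoRiemannianMetric m M)
    (he : e ∈ atlas (EuclideanSpace ℝ (Fin m)) M) (hq : q ∈ e.target) (p : Coord m) :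
    gramOp g e q (cogramOp g e q p) = p :=
  (gramOp_isInvertible g he hq).self_apply_inverse p

theorem contDiffOn_cogramOp (g : PseudoRiemannianMetric m M)
    (he : e ∈ atlas (EuclideanSpace ℝ (Fin m)) M) : ContDiffOn ℝ ∞ (cogramOp g e) e.target :=
  fun q hq => (gramOp_isInvertible g he hq).contDiffAt_map_inverse.comp_contDiffWithinAt q
    (contDiffOn_gramOp g he q hq)

theorem sum_cogramOp_mul_comm (g : PseudoRiemannianMetric m M)
    (he : e ∈ atlas (EuclideanSpace ℝ (Fin m)) M) (hq : q ∈ e.target) (v w : Coord m) :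
    ∑ i, (cogramOp g e q v).ofLp i * w.ofLp i = ∑ i, v.ofLp i * (cogramOp g e q w).ofLp i := by
  have := sum_gramOp_mul_comm (e := e) (q := q) g (cogramOp g e q v) (cogramOp g e q w)
  rw [gramOp_cogramOp g he hq, gramOp_cogramOp g he hq] at this
  exact this.symm

theorem inCoords_hamiltonian (g : PseudoRiemannianMetric m M)
    (he : e ∈ atlas (EuclideanSpace ℝ (Fin m)) M) (hq : q ∈ e.target) (p : Coord m) :
    inCoords e g.hamiltonian q p = (1 / 2 : ℝ) * inner ℝ p (cogramOp g e q p) := by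
  set c : Cotangent m (e.symm q) := ∑ i, p i • coordCovec e q i with hc
  set v := cogramOp g e q p with hv
  have hcw : ∀ w, c w = ∑ i, p.ofLp i * coordCovec e q i w := fun w => by
    simp [hc]
  have hsharp : g.sharp (e.symm q) c = ∑ j, v.ofLp j • coordVec e q j := by
    refine (LinearEquiv.symm_apply_eq _).2 ?_
    refine ContinuousLinearMap.ext fun w => ?_
    change c w = g.val (e.symm q) (∑ j, v.ofLp j • coordVec e q j) w
    have := sum_gramOp_mul (e := e) (q := q) g v (.toLp 2 fun i => coordCovec e q i w)
    rw [sum_coordCovec_smul_coordVec he hq w, hv, gramOp_cogramOp g he hq] at this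
    rw [hcw, ← this]
  change (1 / 2 : ℝ) * c (g.sharp (e.symm q) c) = _
  rw [hsharp, hcw]
  simp [coordCovec_coordVec he hq, PiLp.inner_apply, mul_comm]

/-- The momentum part `-∂H/∂q` of the geodesic field. -/
def momentumField (g : PseudoRiemannianMetric m M)
    (e : OpenPartialHomeomorph M (EuclideanSpace ℝ (Fin m))) (q p : Coord m) : Coord m :=
  ∑ i, (-(1 / 2 : ℝ) * inner ℝ p (fderiv ℝ (cogramOp g e) q (stdVec i) p)) • stdVec i

theorem geodesicField (g : PseudoRiemannianMetric m M)
    (he : e ∈ atlas (EuclideanSpace ℝ (Fin m)) M) :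
    GeodesicField e.target (cogramOp g e) (momentumField g e) where
  isOpen := e.open_target
  smooth_fst := contDiffOn_cogramOp g he
  smooth_snd := by
    unfold momentumField
    refine ContDiffOn.sum fun i _ => ContDiffOn.smul (contDiffOn_const.mul
      (ContDiffOn.inner ℝ contDiffOn_snd (ContDiffOn.clm_apply (ContDiffOn.clm_apply ?_
        contDiffOn_const) contDiffOn_snd))) contDiffOn_const
    exact ((contDiffOn_cogramOp g he).fderiv_of_isOpen e.open_target (m := ∞) le_rfl).comp
      contDiffOn_fst fun z hz => hz.1
  bijective q hq := by
    have h := gramOp_isInvertible g he hq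
    obtain ⟨E, hE⟩ := h
    rw [cogramOp, ← hE, ContinuousLinearMap.inverse_equiv]
    exact E.symm.bijective
  quadratic q hq s p := by
    simp only [momentumField, map_smul, inner_smul_left, inner_smul_right, Finset.smul_sum,
      smul_smul]
    refine Finset.sum_congr rfl fun i _ => ?_
    congr 1
    simp
    ring

/-- The bracket with H is differentiation along the Hamiltonian field (∂H/∂p, -∂H/∂q). Symmetry of
the inverse metric turns ∂H/∂p into `cogramOp` applied to p. -/
theorem IsRelativeKilling.isTransported {g : PseudoRiemannianMetric m M} {L K : CotangentFun m M}
    (hK : IsRelativeKilling g L K) (he : e ∈ atlas (EuclideanSpace ℝ (Fin m)) M) :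
    IsTransported e.target (cogramOp g e) (momentumField g e) (inCoords e L) (inCoords e K) := by
  intro q hq p
  rw [← hK e he q hq p, poissonBracket, Finset.sum_sub_distrib]
  have hp : ∀ i, fderiv ℝ (fun p' => inCoords e g.hamiltonian q p') p (stdVec i)
      = (cogramOp g e q p).ofLp i := by
    intro i
    have h1 : (fun p' => inCoords e g.hamiltonian q p')
        = fun p' => (1 / 2 : ℝ) * inner ℝ p' (cogramOp g e q p') :=
      funext fun p' => inCoords_hamiltonian g he hq p'
    have h2 := sum_cogramOp_mul_comm g he hq p (stdVec i)
    rw [h1, fderiv_const_mul (DifferentiableAt.inner ℝ (by fun_prop) (by fun_prop)), smul_apply,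
      fderiv_inner_apply ℝ (by fun_prop) (by fun_prop), ContinuousLinearMap.fderiv]
    simp only [fderiv_fun_id, ContinuousLinearMap.id_apply]
    have e1 : inner ℝ p (cogramOp g e q (stdVec i)) = (cogramOp g e q p).ofLp i := by
      rw [PiLp.inner_apply]
      simp only [RCLike.inner_apply, conj_trivial]
      simp only [mul_comm (_ : ℝ) (p.ofLp _)]
      rw [← h2]
      simp [stdVec]
    have e2 : inner ℝ (stdVec i) (cogramOp g e q p) = (cogramOp g e q p).ofLp i := by
      exact (EuclideanSpace.inner_single_left i (1 : ℝ) _).trans (by simp)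
    rw [e1, e2, smul_eq_mul]
    ring
  have hqd : ∀ i, fderiv ℝ (fun q' => inCoords e g.hamiltonian q' p) q (stdVec i)
      = -(momentumField g e q p).ofLp i := by
    intro i
    have h1 : (fun q' => inCoords e g.hamiltonian q' p)
        =ᶠ[𝓝 q] fun q' => (1 / 2 : ℝ) * inner ℝ p (cogramOp g e q' p) := by
      filter_upwards [e.open_target.mem_nhds hq] with q' hq'
      exact inCoords_hamiltonian g he hq' p
    have hA : DifferentiableAt ℝ (cogramOp g e) q :=
      ((contDiffOn_cogramOp g he).contDiffAt (e.open_target.mem_nhds hq)).differentiableAt (by simp)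
    rw [h1.fderiv_eq, fderiv_const_mul (DifferentiableAt.inner ℝ (by fun_prop) (by fun_prop)), smul_apply,
      fderiv_inner_apply ℝ (by fun_prop) (by fun_prop),
      fderiv_clm_apply hA (differentiableAt_const _)]
    simp [momentumField, stdVec, Pi.single_apply]
  have hexp : ∀ u : Coord m, u = ∑ i, u.ofLp i • stdVec i := fun u => by
    ext j; simp [stdVec, Pi.single_apply]
  conv_lhs => rw [hexp (cogramOp g e q p), hexp (momentumField g e q p)]
  simp [hp, hqd]

end RelativeKilling
end

/-! ### The filtration by order of vanishing and the global bound -/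

noncomputable section

namespace RelativeKilling

open MvPolynomial Set Topology Metric

variable {m d n : ℕ}

theorem iteratedFDeriv_eq_zero_of_diagonal {E : Type*} [NormedAddCommGroup E] [NormedSpace ℝ E]
    {U : Set E} {x : E} (hU : IsOpen U) (hx : x ∈ U) (n : ℕ) :
    ∀ {c : E → ℝ} (_ : ContDiffOn ℝ ∞ c U)
      (_ : ∀ h, iteratedFDeriv ℝ n c x (fun _ => h) = 0), iteratedFDeriv ℝ n c x = 0 := by
  classical
  induction n with
  | zero =>
    intro c _ h
    ext v
    rw [Subsingleton.elim v fun _ => 0]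
    exact h 0
  | succ n ih =>
    intro c hc h
    have hd : ∀ v : E, ContDiffOn ℝ ∞ (fun q => fderiv ℝ c q v) U := fun v =>
      (hc.fderiv_of_isOpen hU (m := ∞) le_rfl).clm_apply contDiffOn_const
    have hv : ∀ v, iteratedFDeriv ℝ n (fun q => fderiv ℝ c q v) x = 0 := by
      refine fun v => ih (hd v) fun w => ?_
      rw [iteratedFDeriv_fderiv_apply hU hx hc]
      have hline : HasDerivAt (fun (t : ℝ) (_ : Fin (n + 1)) => w + t • v) (fun _ => v) 0 := by
        rw [hasDerivAt_pi]
        intro i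
        simpa using ((hasDerivAt_id (0 : ℝ)).smul_const v).const_add w
      have h3 := ((iteratedFDeriv ℝ (n + 1) c x).hasFDerivAt
        (fun _ : Fin (n + 1) => w + (0 : ℝ) • v)).comp_hasDerivAt (0 : ℝ) hline
      -- Polarization: the diagonal values are zero along w + t v, and the derivative at t = 0 is n
      -- + 1 times the value with one v.
      have h4 := h3.unique (by simpa [Function.comp_def, h] using hasDerivAt_const (0 : ℝ) (0 : ℝ))
      rw [ContinuousMultilinearMap.linearDeriv_apply] at h4
      simp only [zero_smul, add_zero, iteratedFDeriv_update_const hU hx n hc] at h4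
      rw [Finset.sum_const, Finset.card_univ, Fintype.card_fin] at h4
      exact (smul_eq_zero.1 h4).resolve_left (by omega)
    ext w
    have := congrArg (fun T => T (Fin.init w)) (hv (w (Fin.last n)))
    simp only [iteratedFDeriv_fderiv_apply hU hx hc, Fin.snoc_init_self] at this
    exact this

/-- By rank-nullity dim F n ≤ dim T n + dim F (n + 1), because the kernel of f n embeds in F (n +
1). Finiteness is part of the conclusion and is carried through the same induction. -/
theorem finite_and_finrank_le_of_filtration {V W : Type*} [AddCommGroup V] [Module ℝ V]
    [AddCommGroup W] [Module ℝ W] (N : ℕ) : ∀ (F : ℕ → Submodule ℝ V) (f : ∀ n, F n →ₗ[ℝ] W)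
    (T : ℕ → Submodule ℝ W) (_ : ∀ n, Module.Finite ℝ (T n)) (_ : ∀ n x, f n x ∈ T n)
    (_ : ∀ n x, f n x = 0 → (x : V) ∈ F (n + 1)) (_ : F N = ⊥),
    Module.Finite ℝ (F 0) ∧
      Module.finrank ℝ (F 0) ≤ ∑ k ∈ Finset.range N, Module.finrank ℝ (T k) := by
  induction N with
  | zero =>
    intro F f T _ _ _ hF
    rw [hF]
    exact ⟨inferInstance, by simp⟩
  | succ N ih =>
    intro F f T hT hf hker hF
    obtain ⟨hfin, hle⟩ := ih (fun n => F (n + 1)) (fun n => f (n + 1)) (fun n => T (n + 1))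
      (fun n => hT _) (fun n => hf _) (fun n => hker _) hF
    let i : LinearMap.ker (f 0) →ₗ[ℝ] F 1 :=
      ((F 0).subtype.comp (LinearMap.ker (f 0)).subtype).codRestrict (F 1) fun x => hker 0 _ x.2
    have hi : Function.Injective i := fun x y h => by
      have := congrArg Subtype.val h
      exact Subtype.ext (Subtype.ext this)
    have hkfin : Module.Finite ℝ (LinearMap.ker (f 0)) := Module.Finite.of_injective i hi
    have hrange : LinearMap.range (f 0) ≤ T 0 := by
      rintro _ ⟨x, rfl⟩
      exact hf 0 x
    have := hT 0
    have hrfin : Module.Finite ℝ (LinearMap.range (f 0)) :=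
      Submodule.finiteDimensional_of_le hrange
    have hF0 : Module.Finite ℝ (F 0) := by
      refine ⟨Submodule.fg_of_fg_map_of_fg_inf_ker (f 0) ?_ ?_⟩
      · rw [Submodule.map_top]
        exact Module.Finite.iff_fg.1 hrfin
      · rw [top_inf_eq]
        exact Module.Finite.iff_fg.1 hkfin
    refine ⟨hF0, ?_⟩
    rw [← (f 0).finrank_range_add_finrank_ker, Finset.sum_range_succ', add_comm]
    exact add_le_add ((LinearMap.finrank_le_finrank_of_injective hi).trans hle)
      (Submodule.finrank_mono hrange)

variable {M : Type*} [TopologicalSpace M] [ChartedSpace (EuclideanSpace ℝ (Fin m)) M]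
  {e : OpenPartialHomeomorph M (EuclideanSpace ℝ (Fin m))} {q : Coord m}

/-- The tensors in `S` whose expression in the chart `e` vanishes to order `n` at `q`. -/
def vanishingSubmodule (S : Submodule ℝ (CotangentFun m M)) (hS : ∀ K ∈ S, IsSymTensor d K)
    (he : e ∈ atlas (EuclideanSpace ℝ (Fin m)) M) (hq : q ∈ e.target) (n : ℕ) :
    Submodule ℝ (CotangentFun m M) where
  carrier := {K | K ∈ S ∧ ∀ p, VanishesToOrder n (fun q' => inCoords e K q' p) q}
  zero_mem' := ⟨S.zero_mem, fun p j _ => by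
    change iteratedFDeriv ℝ j (fun _ => (0 : ℝ)) q = 0
    rw [iteratedFDeriv_fun_zero]; rfl⟩
  add_mem' := by
    rintro K₁ K₂ ⟨h₁, v₁⟩ ⟨h₂, v₂⟩
    refine ⟨S.add_mem h₁ h₂, fun p j hj => ?_⟩
    have hat : ∀ K ∈ S, ContDiffAt ℝ j (fun q' => inCoords e K q' p) q := fun K hK =>
      ((contDiffOn_left (hS K hK |>.smooth e he) p).contDiffAt (e.open_target.mem_nhds hq)).of_le
        (by exact_mod_cast le_top)
    refine (iteratedFDeriv_add_apply (hat K₁ h₁) (hat K₂ h₂)).trans ?_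
    rw [v₁ p j hj, v₂ p j hj, add_zero]
  smul_mem' := by
    rintro a K ⟨h, v⟩
    refine ⟨S.smul_mem a h, fun p j hj => ?_⟩
    have hat : ContDiffAt ℝ j (fun q' => inCoords e K q' p) q :=
      ((contDiffOn_left (hS K h |>.smooth e he) p).contDiffAt (e.open_target.mem_nhds hq)).of_le
        (by exact_mod_cast le_top)
    refine (iteratedFDeriv_const_smul_apply' (a := a) hat).trans ?_
    rw [v p j hj, smul_zero]

/-- The leading part of degree `n`, in positions and velocities `v` with `p = B v`. -/
def leadingMap (S : Submodule ℝ (CotangentFun m M)) (hS : ∀ K ∈ S, IsSymTensor d K)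
    (he : e ∈ atlas (EuclideanSpace ℝ (Fin m)) M) (hq : q ∈ e.target) (B : Coord m → Coord m)
    (n : ℕ) : vanishingSubmodule S hS he hq n →ₗ[ℝ] (Coord m → Coord m → ℝ) where
  toFun K h v := leadingPart n (inCoords e K) q h (B v)
  map_add' K₁ K₂ := by
    ext h v
    have hat : ∀ K : vanishingSubmodule S hS he hq n,
        ContDiffAt ℝ n (fun q' => inCoords e (K : CotangentFun m M) q' (B v)) q := fun K =>
      ((contDiffOn_left (hS K K.2.1 |>.smooth e he) _).contDiffAt
        (e.open_target.mem_nhds hq)).of_le (by exact_mod_cast le_top)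
    exact congrArg (fun T => T fun _ => h) (iteratedFDeriv_add_apply (hat K₁) (hat K₂))
  map_smul' a K := by
    ext h v
    have hat : ContDiffAt ℝ n (fun q' => inCoords e (K : CotangentFun m M) q' (B v)) q :=
      ((contDiffOn_left (hS K K.2.1 |>.smooth e he) _).contDiffAt
        (e.open_target.mem_nhds hq)).of_le (by exact_mod_cast le_top)
    exact congrArg (fun T => T fun _ => h) (iteratedFDeriv_const_smul_apply' (a := a) hat)

theorem mem_vanishingSubmodule_succ {S : Submodule ℝ (CotangentFun m M)}
    {hS : ∀ K ∈ S, IsSymTensor d K} {he : e ∈ atlas (EuclideanSpace ℝ (Fin m)) M}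
    {hq : q ∈ e.target} {B : Coord m → Coord m} (hB : Function.Surjective B)
    (K : vanishingSubmodule S hS he hq n) (h0 : leadingMap S hS he hq B n K = 0) :
    (K : CotangentFun m M) ∈ vanishingSubmodule S hS he hq (n + 1) := by
  refine ⟨K.2.1, fun p j hj => ?_⟩
  rcases Nat.lt_succ_iff_lt_or_eq.1 hj with hj | rfl
  · exact K.2.2 p j hj
  · obtain ⟨v, rfl⟩ := hB p
    exact iteratedFDeriv_eq_zero_of_diagonal e.open_target hq _
      (contDiffOn_left (hS K K.2.1 |>.smooth e he) _) fun h => congrFun (congrFun h0 h) v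

/-- Evaluation of polynomials on positions and momenta. -/
def evalPhase (m : ℕ) : PhasePoly m →ₗ[ℝ] (Coord m → Coord m → ℝ) :=
  LinearMap.pi fun h => LinearMap.pi fun v =>
    (aeval (R := ℝ) (S₁ := ℝ) (Sum.elim h.ofLp v.ofLp)).toLinearMap

theorem evalPhase_apply (Q : PhasePoly m) (h v : Coord m) :
    evalPhase m Q h v = eval (Sum.elim h.ofLp v.ofLp) Q := by
  simp [evalPhase, aeval_eq_eval]

variable [IsManifold (𝓡 m) ∞ M] {g : PseudoRiemannianMetric m M} {L K : CotangentFun m M}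

theorem exists_ball_forall_tensor_eq_zero (hL : IsSymTensor 1 L)
    (hK : K ∈ relativeKillingTensors g L d) (he : e ∈ atlas (EuclideanSpace ℝ (Fin m)) M)
    (hq : q ∈ e.target) :
    ∃ r > 0, ball q r ⊆ e.target ∧ ∀ q₁ ∈ ball q r,
      (∀ p, VanishesToOrder (d + 1) (fun q' => inCoords e K q' p) q₁) →
        ∀ q₂ ∈ ball q r, ∀ c, K (e.symm q₂) c = 0 := by
  obtain ⟨r, hr, hsub, h⟩ := exists_ball_forall_eq_zero (geodesicField g he)
    (hK.1.smoothForm he) (hL.smooth e he) (hK.2.isTransported he) hq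
  refine ⟨r, hr, hsub, fun q₁ hq₁ hv q₂ hq₂ c => ?_⟩
  rw [eq_sum_smul_coordCovec he (hsub hq₂) c]
  exact h q₁ hq₁ hv q₂ hq₂ (.toLp 2 fun i => c (coordVec e q₂ i))

/-- The interior Z of the zero set is open by construction and nonempty by the local result. It is
closed because a limit point has a ball, given by the local result around it, that meets Z; at a
point of Z all derivatives of K are zero. -/
theorem eq_zero_of_vanishesToOrder [ConnectedSpace M] (hL : IsSymTensor 1 L)
    (hK : K ∈ relativeKillingTensors g L d) (he : e ∈ atlas (EuclideanSpace ℝ (Fin m)) M)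
    (hq : q ∈ e.target) (hv : ∀ p, VanishesToOrder (d + 1) (fun q' => inCoords e K q' p) q) :
    K = 0 := by
  let Z : Set M := {x | ∀ᶠ y in 𝓝 x, ∀ c, K y c = 0}
  have hspread : ∀ {e : OpenPartialHomeomorph M (EuclideanSpace ℝ (Fin m))} {r : ℝ} {x : M}
      {y : Coord m}, x ∈ e.source → e x ∈ ball y r → (∀ q₂ ∈ ball y r, ∀ c, K (e.symm q₂) c = 0) →
      x ∈ Z := by
    intro e r x y hx hxr h
    have hnhds : e.source ∩ e ⁻¹' ball y r ∈ 𝓝 x :=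
      (e.isOpen_inter_preimage isOpen_ball).mem_nhds ⟨hx, hxr⟩
    filter_upwards [hnhds] with z hz c
    have h1 := h (e z) hz.2
    rw [e.left_inv hz.1] at h1
    exact h1 c
  have hne : Z.Nonempty := by
    obtain ⟨r, hr, hsub, h⟩ := exists_ball_forall_tensor_eq_zero hL hK he hq
    refine ⟨e.symm q, hspread (e.map_target hq) ?_ (h q (mem_ball_self hr) hv)⟩
    rw [e.right_inv hq]
    exact mem_ball_self hr
  have hopen : IsOpen Z := isOpen_setOfPred_eventually_nhds
  have hclosed : IsClosed Z := by
    refine isClosed_of_closure_subset fun x hx => ?_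
    let e' := chartAt (EuclideanSpace ℝ (Fin m)) x
    have hxs : x ∈ e'.source := mem_chart_source _ x
    obtain ⟨r, hr, hsub, h⟩ := exists_ball_forall_tensor_eq_zero hL hK
      (chart_mem_atlas (EuclideanSpace ℝ (Fin m)) x) (e'.map_source hxs)
    have hnhds : e'.source ∩ e' ⁻¹' ball (e' x) r ∈ 𝓝 x :=
      (e'.isOpen_inter_preimage isOpen_ball).mem_nhds ⟨hxs, mem_ball_self hr⟩
    obtain ⟨z, ⟨hzs, hzr⟩, hzZ⟩ := mem_closure_iff_nhds.1 hx _ hnhds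
    refine hspread hxs (mem_ball_self hr) (h (e' z) hzr fun p j _ => ?_)
    have hz0 : (fun q' => inCoords e' K q' p) =ᶠ[𝓝 (e' z)] fun _ => 0 := by
      have hc : Filter.Tendsto e'.symm (𝓝 (e' z)) (𝓝 z) := by
        have := e'.continuousAt_symm (e'.map_source hzs)
        rwa [ContinuousAt, e'.left_inv hzs] at this
      filter_upwards [hc.eventually hzZ] with q' hq'
      exact hq' _
    rw [(hz0.iteratedFDeriv ℝ j).eq_of_nhds, iteratedFDeriv_fun_zero]
    rfl
  have huniv : Z = univ := IsClopen.eq_univ ⟨hclosed, hopen⟩ hne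
  funext x
  have hx : x ∈ Z := huniv ▸ mem_univ x
  exact funext hx.self_of_nhds

theorem finite_and_finrank_relativeKillingTensors_le [ConnectedSpace M]
    (g : PseudoRiemannianMetric m M) (hL : IsSymTensor 1 L) (d : ℕ) :
    FiniteDimensional ℝ (relativeKillingTensors g L d) ∧
      Module.finrank ℝ (relativeKillingTensors g L d)
        ≤ ∑ k ∈ Finset.range (d + 1), Module.finrank ℝ (raiseKer m k d) := by
  obtain ⟨x⟩ : Nonempty M := inferInstance
  let e := chartAt (EuclideanSpace ℝ (Fin m)) x
  have he : e ∈ atlas (EuclideanSpace ℝ (Fin m)) M := chart_mem_atlas _ x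
  have hq : e x ∈ e.target := e.map_source (mem_chart_source _ x)
  let S := relativeKillingTensors g L d
  have hS : ∀ K ∈ S, IsSymTensor d K := fun K hK => hK.1
  -- Lowering the index at the base point: with p = B v, the principal part of the transport
  -- equation there becomes v · ∂/∂h.
  let B := gramOp g e (e x)
  have hAB : ∀ v, cogramOp g e (e x) (B v) = v := fun v =>
    (gramOp_isInvertible g he hq).inverse_apply_self v
  have hB : Function.Surjective B := fun p => ⟨cogramOp g e (e x) p, gramOp_cogramOp g he hq p⟩
  obtain ⟨hfin, hle⟩ := finite_and_finrank_le_of_filtration (d + 1)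
    (vanishingSubmodule S hS he hq) (leadingMap S hS he hq B)
    (fun n => (raiseKer m n d).map (evalPhase m)) (fun n => inferInstance)
    (fun n K => by
      obtain ⟨Q, hQ, hlead⟩ := leadingPart_mem_raiseKer (geodesicField g he)
        (K.2.1.1.smoothForm he) (hL.smooth e he) (K.2.1.2.isTransported he) hq K.2.2 hAB
      refine ⟨Q, hQ, ?_⟩
      ext h v
      rw [evalPhase_apply, ← hlead]
      rfl)
    (fun n K hK => mem_vanishingSubmodule_succ hB K hK)
    (by
      rw [eq_bot_iff]
      rintro K ⟨hK, hv⟩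
      exact eq_zero_of_vanishesToOrder hL hK he hq hv)
  have h0 : vanishingSubmodule S hS he hq 0 = S :=
    le_antisymm (fun K hK => hK.1) fun K hK => ⟨hK, fun p j hj => absurd hj (by omega)⟩
  rw [h0] at hfin hle
  exact ⟨hfin, hle.trans (Finset.sum_le_sum fun k _ => Submodule.finrank_map_le _ _)⟩

end RelativeKilling
end

theorem theorem1 (m d : ℕ) (hm : 1 ≤ m) (M : Type*) [TopologicalSpace M]
    [ChartedSpace (EuclideanSpace ℝ (Fin m)) M] [IsManifold (𝓡 m) ∞ M] [ConnectedSpace M]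
    (g : RelativeKilling.PseudoRiemannianMetric m M)
    (L : RelativeKilling.CotangentFun m M) (hL : RelativeKilling.IsSymTensor 1 L) :
    FiniteDimensional ℝ (RelativeKilling.relativeKillingTensors g L d) ∧
      (Module.finrank ℝ (RelativeKilling.relativeKillingTensors g L d) : ℚ)
        ≤ RelativeKilling.killingBound m d := by
  obtain ⟨hfin, hle⟩ :=
    RelativeKilling.finite_and_finrank_relativeKillingTensors_le g hL d
  refine ⟨hfin, ?_⟩
  rw [← RelativeKilling.sum_finrank_raiseKer hm d]
  exact_mod_cast hle
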